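/- Let $\Sigma$ be a compact connected smooth surface without boundary, endowed with a smooth Riemannian metric, and let $d$ be its Riemannian distance. Let $\mathcal M(\Sigma)$ be the set of all (finite, signed) Radon measures on $\Sigma$, with the norm $$\|\mu\|_{Lip'(\Sigma)}=\sup_{\|f\|_{Lip(\Sigma)}\le 1}\left|\int_\Sigma f\,d\mu\right|,\qquad \|f\|_{Lip(\Sigma)}=\max\left\{\sup_{\Sigma}|f|,\ \sup_{x\ne y}\frac{|f(x)-f(y)|}{d(x,y)}\right\},$$ and let $d_{KR}(\mu,\nu)=\|\mu-\nu\|_{Lip'(\Sigma)}$ be the Kantorovich–Rubinstein distance. For $k\in\mathbb N$ let $$\Sigma_k=\Big\{\sum_{j=1}^k t_j\delta_{x_j}:\ t_j\ge 0,\ \sum_{j=1}^k t_j=1,\ x_j\in\Sigma\Big\}.$$ Then for every $k\in\mathbb N$ and every sufficiently small $\varepsilon_0>0$ there is a retraction $$\psi_k:\{\sigma\in\mathcal M(\Sigma):\ d_{KR}(\sigma,\Sigma_k)<\varepsilon_0\}\to\Sigma_k$$ (that is, $\psi_k(\sigma)=\sigma$ for all $\sigma\in\Sigma_k$) which is continuous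 with respect to $d_{KR}$. In particular, if $\sigma_n\in\mathcal M(\Sigma)$ converges weakly to $\sigma\in\Sigma_k$, i.e. $\int_\Sigma f\,d\sigma_n\to\int_\Sigma f\,d\sigma$ for all $f\in C(\Sigma)$, then $d_{KR}(\sigma_n,\Sigma_k)<\varepsilon_0$ for all large $n$, and $\psi_k(\sigma_n)\to\sigma$ with respect to $d_{KR}$. -/

import Mathlib

open MeasureTheory Filter Topology Bundle
open scoped Manifold ContDiff

section KantorovichRubinstein

variable {M : Type*} [MetricSpace M] [MeasurableSpace M] [BorelSpace M]

/-- The closed unit ball of `Lip(M)` for the norm `‖f‖ = max (sup |f|) (Lipschitz constant of f)`. -/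
def lipUnitBall (M : Type*) [MetricSpace M] : Set (M → ℝ) :=
  {f | (∀ x, |f x| ≤ 1) ∧ LipschitzWith 1 f}

/-- The dual Lipschitz norm `sup {|∫ f dμ| : ‖f‖_Lip ≤ 1}` of a finite signed Borel measure.
The supremum is finite, see `bddAbove_lipPairing`. On a compact metric space the finite signed
Borel measures are exactly the (signed) Radon measures. -/
noncomputable def lipDualNorm (μ : SignedMeasure M) : ℝ :=
  ⨆ f : lipUnitBall M, |∫ᵛ x, (f : M → ℝ) x ∂<•μ|

theorem integrable_of_bounded_continuous (μ : SignedMeasure M) {f : M → ℝ} {C : ℝ}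
    (hf : Continuous f) (hC : ∀ x, |f x| ≤ C) : VectorMeasure.Integrable μ f := by
  have : IsFiniteMeasure μ.variation := by
    rw [← SignedMeasure.totalVariation_eq_variation]; infer_instance
  exact Integrable.of_bound hf.measurable.aestronglyMeasurable C (.of_forall hC)

theorem integrable_of_mem_lipUnitBall (μ : SignedMeasure M) {f : M → ℝ}
    (hf : f ∈ lipUnitBall M) : VectorMeasure.Integrable μ f :=
  integrable_of_bounded_continuous μ hf.2.continuous hf.1

theorem bddAbove_lipPairing (μ : SignedMeasure M) :
    BddAbove (Set.range fun f : lipUnitBall M => |∫ᵛ x, (f : M → ℝ) x ∂<•μ|) := by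
  have : IsFiniteMeasure μ.variation := by
    rw [← SignedMeasure.totalVariation_eq_variation]; infer_instance
  refine ⟨1 * ‖(ContinuousLinearMap.lsmul ℝ ℝ (E := ℝ)).flip‖ * μ.variation.real Set.univ, ?_⟩
  rintro _ ⟨f, rfl⟩
  have hf : ∀ x, ‖(f : M → ℝ) x‖ ≤ 1 := f.2.1
  exact VectorMeasure.norm_integral_le_of_norm_le_const (μ := μ)
    (B := (ContinuousLinearMap.lsmul ℝ ℝ).flip) (.of_forall hf)

theorem le_lipDualNorm (μ : SignedMeasure M) {f : M → ℝ} (hf : f ∈ lipUnitBall M) :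
    |∫ᵛ x, f x ∂<•μ| ≤ lipDualNorm μ :=
  le_ciSup (bddAbove_lipPairing μ) ⟨f, hf⟩

instance (M : Type*) [MetricSpace M] : Nonempty (lipUnitBall M) :=
  ⟨⟨fun _ => 0, fun x => by simp, LipschitzWith.const' 0⟩⟩

theorem integral_lipschitz_eq_zero {μ : SignedMeasure M} (h : lipDualNorm μ = 0)
    {f : M → ℝ} {K : NNReal} {C : ℝ} (hf : LipschitzWith K f) (hC : ∀ x, |f x| ≤ C) :
    ∫ᵛ x, f x ∂<•μ = 0 := by
  set a : ℝ := (|C| + K + 1)⁻¹ with ha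
  have hpos : 0 < |C| + (K : ℝ) + 1 := by positivity
  have ha0 : 0 < a := inv_pos.2 hpos
  have hmem : (fun x => a • f x) ∈ lipUnitBall M := by
    constructor
    · intro x
      change |a * f x| ≤ 1
      rw [abs_mul, abs_of_pos ha0, ha, inv_mul_le_iff₀ hpos]
      have := hC x
      have := le_abs_self C
      have := K.2
      simp only [NNReal.val_eq_coe] at this
      linarith
    · refine LipschitzWith.of_dist_le_mul fun x y => ?_
      have h1 := hf.dist_le_mul x y
      rw [Real.dist_eq] at h1 ⊢
      rw [← smul_sub, smul_eq_mul, abs_mul, abs_of_pos ha0, ha, inv_mul_le_iff₀ hpos]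
      have h2 : (K : ℝ) * dist x y ≤ (|C| + K + 1) * dist x y := by
        gcongr
        linarith [abs_nonneg C]
      simpa using h1.trans h2
  have h1 := le_lipDualNorm μ hmem
  rw [h, VectorMeasure.integral_fun_smul, smul_eq_mul, abs_mul, abs_of_pos ha0] at h1
  have h2 : |∫ᵛ x, f x ∂<•μ| ≤ 0 := by
    by_contra hne
    push Not at hne
    exact absurd h1 (not_le.2 (mul_pos ha0 hne))
  exact abs_eq_zero.1 (le_antisymm h2 (abs_nonneg _))

theorem eq_zero_of_lipDualNorm_eq_zero {μ : SignedMeasure M} (h : lipDualNorm μ = 0) : μ = 0 := by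
  set p := μ.toJordanDecomposition.posPart with hp
  set n := μ.toJordanDecomposition.negPart with hn
  have hμ : μ = p.toSignedMeasure - n.toSignedMeasure :=
    (SignedMeasure.toSignedMeasure_toJordanDecomposition μ).symm
  have key : ∀ {f : M → ℝ} {K : NNReal} {C : ℝ}, LipschitzWith K f → (∀ x, |f x| ≤ C) →
      ∫ x, f x ∂p = ∫ x, f x ∂n := by
    intro f K C hf hC
    have h0 := integral_lipschitz_eq_zero h hf hC
    rw [hμ, VectorMeasure.integral_sub_vectorMeasure
      (integrable_of_bounded_continuous _ hf.continuous hC)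
      (integrable_of_bounded_continuous _ hf.continuous hC),
      VectorMeasure.integral_toSignedMeasure, VectorMeasure.integral_toSignedMeasure] at h0
    exact sub_eq_zero.1 h0
  have huniv : p Set.univ = n Set.univ := by
    have := key (f := fun _ => (1 : ℝ)) (K := 0) (C := 1) (LipschitzWith.const 1) (by simp)
    simpa [Measure.real, ENNReal.toReal_eq_toReal_iff'] using this
  have hclosed : ∀ F : Set M, IsClosed F → p F = n F := by
    intro F hF
    set δ : ℕ → ℝ := fun m => 1 / ((m : ℝ) + 1)
    have δpos : ∀ m, 0 < δ m := fun m => Nat.one_div_pos_of_nat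
    have δlim : Tendsto δ atTop (𝓝 0) := tendsto_one_div_add_atTop_nhds_zero_nat
    have hp' := tendsto_lintegral_thickenedIndicator_of_isClosed p hF δpos δlim
    have hn' := tendsto_lintegral_thickenedIndicator_of_isClosed n hF δpos δlim
    refine tendsto_nhds_unique hp' (hn'.congr fun m => ?_)
    have hL : LipschitzWith (δ m).toNNReal⁻¹
        (fun x => ((thickenedIndicator (δpos m) F x : NNReal) : ℝ)) :=
      lipschitzWith_thickenedIndicator (δpos m) F
    have hB : ∀ x, |((thickenedIndicator (δpos m) F x : NNReal) : ℝ)| ≤ 1 := fun x => by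
      rw [abs_of_nonneg (NNReal.coe_nonneg _)]
      exact_mod_cast thickenedIndicator_le_one (δpos m) F x
    have h3 := key hL hB
    have hi : ∀ q : Measure M, [IsFiniteMeasure q] →
        ∫⁻ x, (thickenedIndicator (δpos m) F x : ENNReal) ∂q =
          ENNReal.ofReal (∫ x, ((thickenedIndicator (δpos m) F x : NNReal) : ℝ) ∂q) := by
      intro q _
      rw [ofReal_integral_eq_lintegral_ofReal]
      · simp
      · exact Integrable.of_bound hL.continuous.measurable.aestronglyMeasurable 1 (.of_forall hB)
      · exact .of_forall fun x => NNReal.coe_nonneg _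
    rw [hi, hi, h3]
  have hpn : p = n := by
    refine ext_of_generate_finite {F : Set M | IsClosed F} ?_ isPiSystem_isClosed
      (fun F hF => hclosed F hF) huniv
    rw [← borel_eq_generateFrom_isClosed]
    exact BorelSpace.measurable_eq
  rw [hμ]
  ext s hs
  simp [hpn]

/-- The signed measures with the norm `lipDualNorm`; its distance `‖μ - ν‖` is the
Kantorovich-Rubinstein distance. -/
noncomputable instance instLipDualNorm : NormedAddCommGroup (SignedMeasure M) :=
  AddGroupNorm.toNormedAddCommGroup
    { toFun := lipDualNorm
      map_zero' := by simp [lipDualNorm]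
      add_le' := fun μ ν => by
        refine ciSup_le fun f => ?_
        rw [VectorMeasure.integral_add_vectorMeasure (integrable_of_mem_lipUnitBall μ f.2)
          (integrable_of_mem_lipUnitBall ν f.2)]
        exact (abs_add_le _ _).trans (add_le_add (le_lipDualNorm μ f.2) (le_lipDualNorm ν f.2))
      neg' := fun μ => by simp [lipDualNorm, VectorMeasure.integral_neg_vectorMeasure]
      eq_zero_of_map_eq_zero' := fun _ h => eq_zero_of_lipDualNorm_eq_zero h }

theorem dist_eq_lipDualNorm (μ ν : SignedMeasure M) : dist μ ν = lipDualNorm (μ - ν) :=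
  dist_eq_norm μ ν

end KantorovichRubinstein

/-- The formal barycenters of order `k`: the measures `∑ t_j δ_{x_j}` (`k` terms) with
`t_j ≥ 0` and `∑ t_j = 1`. -/
def formalBarycenters (M : Type*) [MeasurableSpace M] (k : ℕ) : Set (SignedMeasure M) :=
  {σ | ∃ (t : Fin k → ℝ) (x : Fin k → M), (∀ j, 0 ≤ t j) ∧ ∑ j, t j = 1 ∧
    σ = ∑ j, t j • VectorMeasure.dirac (x j) (1 : ℝ)}

/-- Weak convergence `σ_n ⇀ σ` of measures, tested against all continuous functions (on a compact
space these are bounded). -/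
def WeaklyConverges {M : Type*} [TopologicalSpace M] [MeasurableSpace M]
    (s : ℕ → SignedMeasure M) (σ : SignedMeasure M) : Prop :=
  ∀ f : C(M, ℝ), Tendsto (fun n => ∫ᵛ x, f x ∂<•(s n)) atTop (𝓝 (∫ᵛ x, f x ∂<•σ))

/-!
Write `Σ_k` for the formal barycenters of order `k`. The retraction exists because `Σ_k` is a
compact, finite-dimensional and locally contractible space, hence a Euclidean neighbourhood retract.

*Finite dimension.* A smooth embedding of `M` in a Euclidean space has Lipschitz coordinates
(`ContMDiff.exists_lipschitzWith`). Two elements of `Σ_k` have at most `2 * k` atoms in total, and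
polynomials of degree `2 * k` in the coordinates interpolate arbitrary values at that many points,
so integrating finitely many Lipschitz functions gives a continuous linear map
`L : SignedMeasure M → ℝ^m` that is injective on the compact set `Σ_k`
(`exists_finite_injOn_formalBarycenters`). If `r` retracts a neighbourhood of `L(Σ_k)` onto
`L(Σ_k)`, then `L⁻¹ ∘ r ∘ L` is the required retraction.

*Local contractibility.* A measure in `Σ_k` close to `∑ t_j δ_{x_j}` is deformed to it, within `Σ_k`,
by fading out the mass far from the `x_j`, contracting the remaining atoms to the `x_j` inside
charts, and adjusting the weights linearly (`pointedLocallyContractible_formalBarycenters`). The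
continuity of these deformations only has to be checked against single continuous functions,
because weak convergence implies convergence for the Kantorovich–Rubinstein distance
(`WeaklyConverges.tendsto`); the same fact yields the last claim of the theorem.

*Neighbourhood retracts.* Let `A ⊆ ℝ^m` be compact and locally contractible. Cover the complement of
`A` by Whitney cells coloured with finitely many colours, cells of equal colour being disjoint, and
label each cell with a nearby point of `A`. Going through the colours one by one, the map built so
far is contracted on each cell towards the label of the cell, for a time given by bump functions
subordinate to the cells (`ColoredCells.exists_map`). There are finitely many steps, each moving
points little near `A`, so the final map extends continuously by the identity of `A`
(`IsCompact.exists_retraction_thickening`).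
-/

/-! ### Pointed local contractibility -/

/-- Every point `a` has a neighbourhood that contracts to `a` inside the whole space, by a homotopy
that keeps `a` fixed. -/
def PointedLocallyContractible (X : Type*) [TopologicalSpace X] : Prop :=
  ∀ a : X, ∃ N ∈ 𝓝 a, ∃ H : X → unitInterval → X,
    ContinuousOn (fun p : X × unitInterval => H p.1 p.2) (N ×ˢ Set.univ) ∧
    (∀ x ∈ N, H x 0 = x) ∧ (∀ x ∈ N, H x 1 = a) ∧ ∀ t, H a t = a

theorem PointedLocallyContractible.of_homeomorph {X Y : Type*} [TopologicalSpace X]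
    [TopologicalSpace Y] (h : PointedLocallyContractible X) (e : X ≃ₜ Y) :
    PointedLocallyContractible Y := by
  intro a
  obtain ⟨N, hN, H, hc, h0, h1, ha⟩ := h (e.symm a)
  refine ⟨e.symm ⁻¹' N, e.symm.continuous.continuousAt hN, fun y t => e (H (e.symm y) t), ?_,
    fun x hx => by simp [h0 _ hx], fun x hx => by simp [h1 _ hx], fun t => by simp [ha]⟩
  refine e.continuous.comp_continuousOn (hc.comp (f := fun p : Y × unitInterval =>
    (e.symm p.1, p.2)) (by fun_prop) fun p hp => ⟨hp.1, trivial⟩)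

/-- `C` contracts `W` to the point `p`, the time parameter being allowed to run over all reals. At
time `1` the map is `p` even off `W`, and the convergence to `p` at this time is uniform on `W`. -/
structure IsContraction {X : Type*} [TopologicalSpace X] (C : X → ℝ → X) (p : X) (W : Set X) :
    Prop where
  cont : ContinuousOn (fun z : X × ℝ => C z.1 z.2) (W ×ˢ Set.univ)
  zero : ∀ y ∈ W, C y 0 = y
  one : ∀ y, C y 1 = p
  near : ∀ O ∈ 𝓝 p, ∀ᶠ t in 𝓝 (1 : ℝ), ∀ y ∈ W, C y t ∈ O

theorem IsContraction.mono {X : Type*} [TopologicalSpace X] {C : X → ℝ → X} {p : X} {V W : Set X}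
    (h : IsContraction C p W) (hVW : V ⊆ W) : IsContraction C p V where
  cont := h.cont.mono (Set.prod_mono_left hVW)
  zero y hy := h.zero y (hVW hy)
  one := h.one
  near O hO := (h.near O hO).mono fun _ ht y hy => ht y (hVW hy)

/-- On a compact space the local contractions exist at a scale that is uniform in the base point. -/
theorem PointedLocallyContractible.exists_uniform {X : Type*} [MetricSpace X] [CompactSpace X]
    (h : PointedLocallyContractible X) {ε : ℝ} (hε : 0 < ε) :
    ∃ δ > 0, ∀ a : X, ∃ (C : X → ℝ → X) (p : X), IsContraction C p (Metric.closedBall a δ) ∧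
      dist p a < ε ∧ ∀ y ∈ Metric.closedBall a δ, ∀ t, dist (C y t) a < ε := by
  have key : ∀ b : X, ∃ r > 0, ∃ H : X → unitInterval → X,
      ContinuousOn (fun p : X × unitInterval => H p.1 p.2) (Metric.closedBall b r ×ˢ Set.univ) ∧
      (∀ x ∈ Metric.closedBall b r, H x 0 = x) ∧ (∀ x ∈ Metric.closedBall b r, H x 1 = b) ∧
      ∀ x ∈ Metric.closedBall b r, ∀ t, dist (H x t) b < ε / 2 := by
    intro b
    obtain ⟨N, hN, H, hc, h0, h1, hb⟩ := h b
    -- the homotopy is stationary at `b`, so by compactness of the interval it moves nearby points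
    -- little
    have hnear : ∀ᶠ x in 𝓝 b, ∀ t ∈ (Set.univ : Set unitInterval), dist (H x t) b < ε / 2 := by
      refine isCompact_univ.eventually_forall_of_forall_eventually fun t _ => ?_
      have hca : ContinuousAt (fun p : X × unitInterval => H p.1 p.2) (b, t) :=
        hc.continuousAt (prod_mem_nhds hN univ_mem)
      have := hca.eventually (Metric.ball_mem_nhds (H b t) (half_pos hε))
      simpa [hb] using this
    obtain ⟨r, hr, hrN⟩ := Metric.nhds_basis_closedBall.mem_iff.1 (inter_mem hN hnear)
    exact ⟨r, hr, H, hc.mono (Set.prod_mono_left fun x hx => (hrN hx).1),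
      fun x hx => h0 x (hrN hx).1, fun x hx => h1 x (hrN hx).1,
      fun x hx t => (hrN hx).2 t trivial⟩
  choose r hr H hc h0 h1 hd using key
  obtain ⟨δ, hδ, hcov⟩ := lebesgue_number_lemma_of_metric (s := (Set.univ : Set X))
    (c := fun b => Metric.ball b (min (r b) (ε / 2))) isCompact_univ
    (fun b => Metric.isOpen_ball) fun x _ => Set.mem_iUnion.2
      ⟨x, Metric.mem_ball_self (lt_min (hr x) (half_pos hε))⟩
  refine ⟨δ / 2, half_pos hδ, fun a => ?_⟩
  obtain ⟨b, hb⟩ := hcov a trivial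
  have hab : dist b a < ε / 2 := by
    have := hb (Metric.mem_ball_self hδ)
    rw [dist_comm]
    exact (Metric.mem_ball.1 this).trans_le (min_le_right _ _)
  have hsub : Metric.closedBall a (δ / 2) ⊆ Metric.closedBall b (r b) := by
    intro x hx
    have : x ∈ Metric.ball a δ := (Metric.mem_closedBall.1 hx).trans_lt (half_lt_self hδ)
    exact ((Metric.mem_ball.1 (hb this)).trans_le (min_le_left _ _)).le
  classical
  have hcomp : IsCompact (Metric.closedBall b (r b)) := Metric.isClosed_closedBall.isCompact
  let C : X → ℝ → X := fun y t => if y ∈ Metric.closedBall b (r b) then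
    H b y (Set.projIcc 0 1 zero_le_one t) else b
  have hCin : ∀ y ∈ Metric.closedBall b (r b), ∀ t, C y t = H b y (Set.projIcc 0 1 zero_le_one t) :=
    fun y hy t => if_pos hy
  have hcont : ContinuousOn (fun z : X × ℝ => C z.1 z.2)
      (Metric.closedBall b (r b) ×ˢ Set.univ) := by
    refine ((hc b).comp (f := fun z : X × ℝ => (z.1, Set.projIcc 0 1 zero_le_one z.2))
      ?_ fun z hz => ⟨hz.1, trivial⟩).congr fun z hz => hCin _ hz.1 _
    exact (continuous_fst.prodMk (continuous_projIcc.comp continuous_snd)).continuousOn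
  have hone : ∀ y, C y 1 = b := by
    intro y
    by_cases hy : y ∈ Metric.closedBall b (r b)
    · rw [hCin y hy, Set.projIcc_right]
      exact h1 b y hy
    · exact if_neg hy
  refine ⟨C, b, IsContraction.mono ⟨hcont, fun y hy => ?_, hone, fun O hO => ?_⟩ hsub, ?_, ?_⟩
  · rw [hCin y hy, Set.projIcc_left]
    exact h0 b y hy
  · have : ∀ᶠ t in 𝓝 (1 : ℝ), ∀ y ∈ Metric.closedBall b (r b),
        y ∈ Metric.closedBall b (r b) → C y t ∈ O := by
      refine hcomp.eventually_forall_of_forall_eventually fun y hy => ?_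
      have hw := hcont (y, 1) ⟨hy, trivial⟩
      have hO' : O ∈ 𝓝 (C (y, (1 : ℝ)).1 (y, (1 : ℝ)).2) := by rw [hone]; exact hO
      have h2 := hw hO'
      rw [Filter.mem_map, mem_nhdsWithin_iff_eventually] at h2
      have h3 : ∀ᶠ z : ℝ × X in 𝓝 (1, y), (z.2, z.1) ∈ Metric.closedBall b (r b) ×ˢ Set.univ →
          C z.2 z.1 ∈ O := (continuous_swap.tendsto ((1 : ℝ), y)).eventually h2
      rw [nhds_prod_eq] at h3 ⊢
      exact h3.mono fun z hz hz2 => hz ⟨hz2, trivial⟩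
    exact this.mono fun t ht y hy => ht y hy hy
  · exact hab.trans (half_lt_self hε)
  · intro y hy t
    rw [hCin y (hsub hy)]
    calc dist _ a ≤ dist _ b + dist b a := dist_triangle _ _ _
      _ < ε / 2 + ε / 2 := add_lt_add (hd b y (hsub hy) _) hab
      _ = ε := add_halves ε

/-- If a condition `P i ε c`, monotone in `ε`, can be met at every level `ε` by the indices `i` of
small enough size `s i`, then the choice `c i` can be made independently of `ε`. -/
theorem exists_uniform_choice {ι γ : Type*} [Nonempty γ] {P : ι → ℝ → γ → Prop}
    (mono : ∀ i ε ε' c, ε ≤ ε' → P i ε c → P i ε' c) {s : ι → ℝ} (hs : ∀ i, 0 < s i)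
    (h : ∀ ε > 0, ∃ δ > 0, ∀ i, s i < δ → ∃ c, P i ε c) :
    ∃ c : ι → γ, ∀ ε > 0, ∃ δ > 0, ∀ i, s i < δ → P i ε (c i) := by
  -- `c i` is chosen for a level within `s i` of the infimum of the attainable ones
  have key : ∀ i, ∃ c, ∀ ε > 0, (∃ c', P i ε c') → P i (ε + s i) c := by
    intro i
    let I : Set ℝ := {ε | 0 < ε ∧ ∃ c', P i ε c'}
    have hI : BddBelow I := ⟨0, fun ε hε => hε.1.le⟩
    rcases I.eq_empty_or_nonempty with hemp | hne
    · exact ⟨Classical.arbitrary γ, fun ε hε hc => absurd (show ε ∈ I from ⟨hε, hc⟩)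
        (by simp [hemp])⟩
    · obtain ⟨e, ⟨_, c, hc⟩, he⟩ := exists_lt_of_csInf_lt hne (lt_add_of_pos_right (sInf I) (hs i))
      refine ⟨c, fun ε hε hc' => mono i e _ c (he.le.trans ?_) hc⟩
      gcongr
      exact csInf_le hI ⟨hε, hc'⟩
  choose c hc using key
  refine ⟨c, fun ε hε => ?_⟩
  obtain ⟨δ, hδ, hP⟩ := h (ε / 2) (half_pos hε)
  refine ⟨min δ (ε / 2), lt_min hδ (half_pos hε), fun i hi => ?_⟩
  refine mono i _ ε _ ?_ (hc i (ε / 2) (half_pos hε) (hP i (hi.trans_le (min_le_left _ _))))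
  have := hi.trans_le (min_le_right δ (ε / 2))
  linarith

/-! ### Whitney cells and the retraction onto a compact locally contractible set -/

/-- A Whitney decomposition of `{x | 0 < d x}` into cells, with finitely many colours `κ`. The cells
of colour `c` are the sets `{x ∈ G c | q c x = i}` for labels `i : ι`; they are disjoint, and open
because `q c` is locally constant on `G c`. The function `φ c` is a bump on each of them, and `s i`
bounds the diameter of the cells with label `i` and is comparable to the values of `d` on them. -/
structure ColoredCells (E : Type*) [PseudoMetricSpace E] (d : E → ℝ) (κ ι : Type*) where
  φ : κ → E → ℝ
  G : κ → Set E
  q : κ → E → ι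
  s : ι → ℝ
  φ_nonneg : ∀ c x, 0 ≤ φ c x
  s_pos : ∀ i, 0 < s i
  exists_pos : ∀ x, 0 < d x → ∃ c, 0 < φ c x
  cont : ∀ c x, 0 < d x → x ∈ G c → ContinuousAt (φ c) x ∧ ∀ᶠ x' in 𝓝 x, x' ∈ G c ∧ q c x' = q c x
  vanish : ∀ c x, 0 < d x → x ∉ G c → ∀ᶠ x' in 𝓝 x, φ c x' = 0
  le_s : ∀ c x, 0 < d x → x ∈ G c → d x ≤ s (q c x)
  s_le : ∀ c x, 0 < d x → x ∈ G c → s (q c x) ≤ 4 * d x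
  dist_le : ∀ c x x', 0 < d x → 0 < d x' → x ∈ G c → x' ∈ G c → q c x = q c x' →
    dist x x' ≤ s (q c x)

namespace ColoredCells

variable {E : Type*} [MetricSpace E] {κ ι : Type*} {A : Set E}

theorem continuousAt_φ {d : E → ℝ} (w : ColoredCells E d κ ι) (c : κ) {x : E} (hx : 0 < d x) :
    ContinuousAt (w.φ c) x := by
  by_cases h : x ∈ w.G c
  · exact (w.cont c x hx h).1
  · exact continuousAt_const.congr ((w.vanish c x hx h).mono fun _ h => h.symm)

theorem continuousAt_sum {d : E → ℝ} (w : ColoredCells E d κ ι) (S : Finset κ) {x : E}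
    (hx : 0 < d x) : ContinuousAt (fun x => ∑ c ∈ S, w.φ c x) x :=
  tendsto_finsetSum S fun c _ => w.continuousAt_φ c hx

theorem sum_nonneg {d : E → ℝ} (w : ColoredCells E d κ ι) (S : Finset κ) (x : E) :
    0 ≤ ∑ c ∈ S, w.φ c x := Finset.sum_nonneg fun c _ => w.φ_nonneg c x

/-- Every cell has a point of `A` within twice its size. -/
theorem exists_label_point (hA : IsCompact A) (hne : A.Nonempty)
    (w : ColoredCells E (Metric.infDist · A) κ ι) (c : κ) (i : ι) :
    ∃ p : A, ∀ x ∈ w.G c, 0 < Metric.infDist x A → w.q c x = i → dist x p ≤ 2 * w.s i := by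
  by_cases h : ∃ x ∈ w.G c, 0 < Metric.infDist x A ∧ w.q c x = i
  · obtain ⟨x, hx, hd, rfl⟩ := h
    obtain ⟨p, hp, hpd⟩ := hA.exists_infDist_eq_dist hne x
    refine ⟨⟨p, hp⟩, fun x' hx' hd' hq => ?_⟩
    have h1 := w.dist_le c x x' hd hd' hx hx' hq.symm
    have h2 := w.le_s c x hd hx
    calc dist x' p ≤ dist x' x + dist x p := dist_triangle _ _ _
      _ ≤ w.s (w.q c x) + w.s (w.q c x) := by
        rw [dist_comm x' x, ← hpd]; exact add_le_add h1 h2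
      _ = _ := by ring
  · obtain ⟨p, hp⟩ := hne
    exact ⟨⟨p, hp⟩, fun x hx hd hq => absurd ⟨x, hx, hd, hq⟩ h⟩

/-- One colour at a time: on the part of the complement of `A` that is covered by the bumps with
colours in `S` there is, near `A`, a continuous map to `A` that moves points little when they are
close to `A`. A new colour `c` is added by contracting the value of the old map on each cell towards
the point that labels the cell, for the time `φ c / (φ c + ∑ over the old colours)`: this time is
`0` where the new bump vanishes, and `1`, so that the value of the old map does not matter, where
all the old bumps vanish. -/
theorem exists_map (hA : IsCompact A) (hne : A.Nonempty) (hc : PointedLocallyContractible A)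
    (w : ColoredCells E (Metric.infDist · A) κ ι) (S : Finset κ) :
    ∃ y : E → A, ∃ η > 0,
      (∀ x, 0 < Metric.infDist x A → Metric.infDist x A < η → 0 < ∑ c ∈ S, w.φ c x →
        ContinuousAt y x) ∧
      ∀ ε > 0, ∃ δ > 0, ∀ x, 0 < Metric.infDist x A → Metric.infDist x A < δ →
        0 < ∑ c ∈ S, w.φ c x → dist (y x : E) x < ε := by
  classical
  have : CompactSpace A := isCompact_iff_compactSpace.1 hA
  have hdc : Continuous fun x => Metric.infDist x A := Metric.continuous_infDist_pt A
  induction S using Finset.induction_on with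
  | empty =>
    exact ⟨fun _ => ⟨hne.some, hne.some_mem⟩, 1, one_pos, by simp, fun ε hε => ⟨1, one_pos, by simp⟩⟩
  | insert c S hcS ih =>
    obtain ⟨y, η, hη, hy, hyd⟩ := ih
    choose p hp using w.exists_label_point hA hne c
    let W : ι → Set A := fun i => {a | ∃ x ∈ w.G c, 0 < Metric.infDist x A ∧ w.q c x = i ∧
      0 < ∑ c ∈ S, w.φ c x ∧ y x = a}
    let P : ι → ℝ → ((A → ℝ → A) × A) → Prop := fun i ε C =>
      IsContraction C.1 C.2 (W i) ∧ dist C.2 (p i) < ε ∧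
        ∀ a ∈ W i, ∀ t, dist (C.1 a t) (p i) < ε
    have : Nonempty A := hne.to_subtype
    obtain ⟨C, hC⟩ : ∃ C : ι → ((A → ℝ → A) × A), ∀ ε > 0, ∃ δ > 0, ∀ i, w.s i < δ →
        P i ε (C i) := by
      refine exists_uniform_choice (fun i ε ε' C h hP => ⟨hP.1, hP.2.1.trans_le h,
        fun a ha t => (hP.2.2 a ha t).trans_le h⟩) w.s_pos fun ε hε => ?_
      obtain ⟨δ₁, hδ₁, h1⟩ := hc.exists_uniform hε
      obtain ⟨δ₂, hδ₂, h2⟩ := hyd (δ₁ / 2) (half_pos hδ₁)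
      refine ⟨min δ₂ (δ₁ / 4), lt_min hδ₂ (by positivity), fun i hi => ?_⟩
      obtain ⟨C, p', hCp, hp', hnear⟩ := h1 (p i)
      have hWsub : W i ⊆ Metric.closedBall (p i) δ₁ := by
        rintro _ ⟨x, hx, hd, rfl, hS, rfl⟩
        have e1 := h2 x hd ((w.le_s c x hd hx).trans_lt (hi.trans_le (min_le_left _ _))) hS
        have e2 := hp _ x hx hd rfl
        have e3 := hi.trans_le (min_le_right _ _)
        have e4 := dist_triangle (y x : E) x (p (w.q c x))
        rw [Metric.mem_closedBall, Subtype.dist_eq]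
        linarith
      exact ⟨(C, p'), hCp.mono hWsub, hp', fun a ha t => hnear a (hWsub ha) t⟩
    let t : E → ℝ := fun x => w.φ c x / (w.φ c x + ∑ c ∈ S, w.φ c x)
    let y' : E → A := fun x => if x ∈ w.G c then (C (w.q c x)).1 (y x) (t x) else y x
    have hy'in : ∀ x ∈ w.G c, y' x = (C (w.q c x)).1 (y x) (t x) := fun x hx => if_pos hx
    have hy'out : ∀ x ∉ w.G c, y' x = y x := fun x hx => if_neg hx
    have ht : ∀ x, 0 < Metric.infDist x A → 0 < w.φ c x + ∑ c ∈ S, w.φ c x →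
        ContinuousAt t x := fun x hx hpos => (w.continuousAt_φ c hx).div
      ((w.continuousAt_φ c hx).add (w.continuousAt_sum S hx)) hpos.ne'
    have ht1 : ∀ x, 0 < w.φ c x + ∑ c ∈ S, w.φ c x → ¬ 0 < ∑ c ∈ S, w.φ c x → t x = 1 := by
      intro x hx h0
      have : ∑ c ∈ S, w.φ c x = 0 := le_antisymm (not_lt.1 h0) (w.sum_nonneg S x)
      simp only [t, this, add_zero] at hx ⊢
      exact div_self hx.ne'
    -- as `s ≤ 4 * d`, the labels of the cells met by `{d < δ₁ / 4}` have the contraction property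
    obtain ⟨δ₁, hδ₁, hC1⟩ := hC 1 one_pos
    refine ⟨y', min η (δ₁ / 4), lt_min hη (by positivity), fun x hx hxη hpos => ?_,
      fun ε hε => ?_⟩
    · rw [Finset.sum_insert hcS] at hpos
      have hdpos : ∀ᶠ x' in 𝓝 x, 0 < Metric.infDist x' A :=
        hdc.continuousAt.eventually (lt_mem_nhds hx)
      have hyx : 0 < ∑ c ∈ S, w.φ c x → ContinuousAt y x :=
        hy x hx (hxη.trans_le (min_le_left _ _))
      have hSpos : 0 < ∑ c ∈ S, w.φ c x → ∀ᶠ x' in 𝓝 x, 0 < ∑ c ∈ S, w.φ c x' := fun h =>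
        (w.continuousAt_sum S hx).eventually (lt_mem_nhds h)
      by_cases hG : x ∈ w.G c
      · have hsi : w.s (w.q c x) < δ₁ := by
          have := w.s_le c x hx hG
          have := hxη.trans_le (min_le_right _ _)
          linarith
        obtain ⟨hCi, -, -⟩ := hC1 _ hsi
        have hloc := (w.cont c x hx hG).2
        by_cases hS : 0 < ∑ c ∈ S, w.φ c x
        · have hcon : ContinuousAt (fun x' => (C (w.q c x)).1 (y x') (t x')) x := by
            have hin : ∀ᶠ x' in 𝓝 x, (y x', t x') ∈ W (w.q c x) ×ˢ (Set.univ : Set ℝ) := by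
              filter_upwards [hloc, hdpos, hSpos hS] with x' h1 h2 h3
              exact ⟨⟨x', h1.1, h2, h1.2, h3, rfl⟩, trivial⟩
            have h1 := hCi.cont (y x, t x) hin.self_of_nhds
            have h2 : Tendsto (fun x' => (y x', t x')) (𝓝 x)
                (𝓝[W (w.q c x) ×ˢ (Set.univ : Set ℝ)] (y x, t x)) :=
              tendsto_nhdsWithin_iff.2 ⟨((hyx hS).prodMk (ht x hx hpos)).tendsto, hin⟩
            exact Tendsto.comp h1 h2
          refine hcon.congr ?_
          filter_upwards [hloc] with x' h1
          rw [hy'in x' h1.1, h1.2]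
        -- only the new bump is positive at `x`; nearby, `t` is close to `1`, so the contraction takes
        -- every value of `y` close to `p`
        · have hy'x : y' x = (C (w.q c x)).2 := by
            rw [hy'in x hG, ht1 x hpos hS, hCi.one]
          have hpos' : ∀ᶠ x' in 𝓝 x, 0 < w.φ c x' + ∑ c ∈ S, w.φ c x' :=
            ((w.continuousAt_φ c hx).add (w.continuousAt_sum S hx)).eventually (lt_mem_nhds hpos)
          have htx := (ht x hx hpos).tendsto
          rw [ht1 x hpos hS] at htx
          intro O hO
          rw [hy'x] at hO
          rw [Filter.mem_map]
          filter_upwards [hloc, hdpos, hpos', htx.eventually (hCi.near O hO)] with x' h1 h2 h3 h4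
          rw [Set.mem_preimage, hy'in x' h1.1, h1.2]
          by_cases hS' : 0 < ∑ c ∈ S, w.φ c x'
          · exact h4 _ ⟨x', h1.1, h2, h1.2, hS', rfl⟩
          · rw [ht1 x' h3 hS', hCi.one]
            exact mem_of_mem_nhds hO
      -- off `G c` the new bump vanishes near `x`, so `t = 0` there and the map does not change
      · have hv := w.vanish c x hx hG
        have hS : 0 < ∑ c ∈ S, w.φ c x := by simpa [hv.self_of_nhds] using hpos
        refine (hyx hS).congr ?_
        have hs4 : ∀ᶠ x' in 𝓝 x, Metric.infDist x' A < δ₁ / 4 :=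
          hdc.continuousAt.eventually (gt_mem_nhds (hxη.trans_le (min_le_right _ _)))
        filter_upwards [hv, hSpos hS, hdpos, hs4] with x' h1 h2 h3 h4
        by_cases hG' : x' ∈ w.G c
        · have hsi : w.s (w.q c x') < δ₁ := by
            have := w.s_le c x' h3 hG'
            linarith
          have h0 := (hC1 _ hsi).1.zero (y x') ⟨x', hG', h3, rfl, h2, rfl⟩
          have ht0 : t x' = 0 := by simp [t, h1]
          rw [hy'in x' hG', ht0, h0]
        · rw [hy'out x' hG']
    · obtain ⟨δ₂, hδ₂, h2⟩ := hyd ε hε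
      obtain ⟨δ₃, hδ₃, h3⟩ := hC (ε / 2) (half_pos hε)
      refine ⟨min δ₂ (min (δ₃ / 4) (ε / 16)), lt_min hδ₂ (lt_min (by positivity) (by positivity)),
        fun x hx hxδ hpos => ?_⟩
      rw [Finset.sum_insert hcS] at hpos
      have e1 := hxδ.trans_le (min_le_left _ _)
      have e2 := hxδ.trans_le ((min_le_right _ _).trans (min_le_left _ _))
      have e3 := hxδ.trans_le ((min_le_right _ _).trans (min_le_right _ _))
      by_cases hG : x ∈ w.G c
      · have hs := w.s_le c x hx hG
        obtain ⟨hCi, hpd, hWd⟩ := h3 (w.q c x) (by linarith)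
        have key : dist (y' x) (p (w.q c x)) < ε / 2 := by
          rw [hy'in x hG]
          by_cases hS : 0 < ∑ c ∈ S, w.φ c x
          · exact hWd _ ⟨x, hG, hx, rfl, hS, rfl⟩ _
          · rw [ht1 x hpos hS, hCi.one]
            exact hpd
        rw [Subtype.dist_eq] at key
        have h4 := dist_triangle (y' x : E) (p (w.q c x)) x
        have h5 := hp _ x hG hx rfl
        rw [dist_comm] at h5
        linarith
      · rw [hy'out x hG]
        refine h2 x hx e1 ?_
        simpa [(w.vanish c x hx hG).self_of_nhds] using hpos

/-- A compact, locally contractible set with a Whitney decomposition of its complement is a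
neighbourhood retract. -/
theorem exists_retraction [Fintype κ] (hA : IsCompact A) (hne : A.Nonempty)
    (hc : PointedLocallyContractible A) (w : ColoredCells E (Metric.infDist · A) κ ι) :
    ∃ (r : E → A) (η : ℝ), 0 < η ∧ ContinuousOn r (Metric.thickening η A) ∧ ∀ a : A, r a = a := by
  classical
  obtain ⟨y, η, hη, hy, hyd⟩ := w.exists_map hA hne hc Finset.univ
  have hsum : ∀ x, 0 < Metric.infDist x A → 0 < ∑ c, w.φ c x := fun x hx => by
    obtain ⟨c, hc⟩ := w.exists_pos x hx
    exact Finset.sum_pos' (fun c _ => w.φ_nonneg c x) ⟨c, Finset.mem_univ c, hc⟩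
  have hd : ∀ x ∉ A, 0 < Metric.infDist x A := fun x hx =>
    (hA.isClosed.notMem_iff_infDist_pos hne).1 hx
  let r : E → A := fun x => if h : x ∈ A then ⟨x, h⟩ else y x
  have hrA : ∀ a : A, r a = a := fun a => dif_pos a.2
  have hrn : ∀ x ∉ A, r x = y x := fun x hx => dif_neg hx
  refine ⟨r, η, hη, fun x hx => ContinuousAt.continuousWithinAt ?_, hrA⟩
  by_cases hxA : x ∈ A
  · rw [Metric.continuousAt_iff]
    intro ε hε
    obtain ⟨δ, hδ, h⟩ := hyd (ε / 2) (half_pos hε)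
    refine ⟨min δ (ε / 2), lt_min hδ (half_pos hε), fun {x'} hx' => ?_⟩
    rw [show r x = ⟨x, hxA⟩ from hrA ⟨x, hxA⟩, Subtype.dist_eq]
    have e1 := hx'.trans_le (min_le_left _ _)
    have e2 := hx'.trans_le (min_le_right _ _)
    by_cases hx'A : x' ∈ A
    · rw [show r x' = ⟨x', hx'A⟩ from hrA ⟨x', hx'A⟩]
      exact e2.trans (half_lt_self hε)
    · rw [hrn x' hx'A]
      have h1 := h x' (hd x' hx'A) ((Metric.infDist_le_dist_of_mem hxA).trans_lt e1)
        (hsum x' (hd x' hx'A))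
      have := dist_triangle (y x' : E) x' x
      change dist (y x' : E) x < ε
      linarith
  · have hlt : Metric.infDist x A < η := by
      rwa [Metric.infDist, ← ENNReal.lt_ofReal_iff_toReal_lt (Metric.infEDist_ne_top hne)]
    refine (hy x (hd x hxA) hlt (hsum x (hd x hxA))).congr ?_
    filter_upwards [hA.isClosed.isOpen_compl.mem_nhds hxA] with x' hx'
    exact (hrn x' hx').symm

end ColoredCells

/-- The periodic bump `max 0 (|sin π v| - 1/2)`, which vanishes near the integers. -/
noncomputable def integerBump (v : ℝ) : ℝ := max 0 (|Real.sin (Real.pi * v)| - 1 / 2)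

theorem integerBump_nonneg (v : ℝ) : 0 ≤ integerBump v := le_max_left _ _

theorem continuous_integerBump : Continuous integerBump := by
  unfold integerBump; fun_prop

/-- The integer bump and its shift by a half never vanish simultaneously. -/
theorem exists_integerBump_pos (v : ℝ) :
    ∃ b : Bool, 0 < integerBump (v + cond b (1 / 2) 0) := by
  by_contra! h
  have h0 := h false
  have h1 := h true
  simp only [integerBump, cond_true, cond_false, add_zero] at h0 h1
  have e0 : |Real.sin (Real.pi * v)| ≤ 1 / 2 := by
    have := (le_max_right _ _).trans h0; linarith
  have e1 : |Real.cos (Real.pi * v)| ≤ 1 / 2 := by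
    have := (le_max_right _ _).trans h1
    rw [mul_add, show Real.pi * (1 / 2) = Real.pi / 2 by ring, Real.sin_add_pi_div_two] at this
    linarith
  have e2 := Real.sin_sq_add_cos_sq (Real.pi * v)
  rw [← sq_abs, ← sq_abs (Real.cos _)] at e2
  nlinarith [abs_nonneg (Real.sin (Real.pi * v)), abs_nonneg (Real.cos (Real.pi * v))]

theorem eventually_integerBump_eq_zero {v : ℝ} (hv : Int.fract v = 0) :
    ∀ᶠ v' in 𝓝 v, integerBump v' = 0 := by
  have h0 : |Real.sin (Real.pi * v)| < 1 / 2 := by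
    obtain ⟨n, rfl⟩ := Int.fract_eq_zero_iff.1 hv
    rw [mul_comm, Real.sin_int_mul_pi]
    norm_num
  have hc : Continuous fun v => |Real.sin (Real.pi * v)| := by fun_prop
  filter_upwards [hc.continuousAt.eventually (gt_mem_nhds h0)] with v' h
  exact max_eq_left (by linarith)

theorem eventually_floor_eq {v : ℝ} (hv : Int.fract v ≠ 0) :
    ∀ᶠ v' in 𝓝 v, Int.fract v' ≠ 0 ∧ ⌊v'⌋ = ⌊v⌋ := by
  have h1 : (⌊v⌋ : ℝ) < v := lt_of_le_of_ne (Int.floor_le v) fun h => hv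
    (Int.fract_eq_zero_iff.2 ⟨_, h⟩)
  filter_upwards [Ioo_mem_nhds h1 (Int.lt_floor_add_one v)] with v' h
  have hf : ⌊v'⌋ = ⌊v⌋ := Int.floor_eq_iff.2 ⟨h.1.le, h.2⟩
  refine ⟨?_, hf⟩
  rw [Int.fract, hf]
  exact (sub_pos.2 h.1).ne'

namespace ColoredCells

variable {σ : Type*}

/-- The shifted logarithmic scale of `d`; its integer part is the generation of a cell. -/
noncomputable def level {E : Type*} (d : E → ℝ) (b : Bool) (x : E) : ℝ :=
  Real.logb 2 (d x) + cond b (1 / 2) 0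

/-- The shifted coordinates at scale `2 ^ n`. -/
noncomputable def scaledCoord (b : σ → Bool) (n : ℤ) (x : σ → ℝ) (i : σ) : ℝ :=
  x i / 2 ^ n + cond (b i) (1 / 2) 0

theorem continuous_scaledCoord (b : σ → Bool) (n : ℤ) (i : σ) :
    Continuous fun x => scaledCoord b n x i := by
  unfold scaledCoord; fun_prop

/-- The Whitney decomposition by dyadic cubes: a cube has side `2 ^ n` where `d` is about `2 ^ n`.
The logarithm of `d` is treated as one more coordinate, and each coordinate comes in two colours,
that is with two grids, shifted against each other by half a mesh. -/
noncomputable def dyadic [Fintype σ] (d : (σ → ℝ) → ℝ) (hd : Continuous d) :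
    ColoredCells (σ → ℝ) d (Bool × (σ → Bool)) (ℤ × (σ → ℤ)) where
  φ c x := integerBump (level d c.1 x) *
    ∏ i, integerBump (scaledCoord c.2 ⌊level d c.1 x⌋ x i)
  G c := {x | Int.fract (level d c.1 x) ≠ 0 ∧
    ∀ i, Int.fract (scaledCoord c.2 ⌊level d c.1 x⌋ x i) ≠ 0}
  q c x := (⌊level d c.1 x⌋, fun i => ⌊scaledCoord c.2 ⌊level d c.1 x⌋ x i⌋)
  s i := 2 ^ (i.1 + 1)
  φ_nonneg c x := mul_nonneg (integerBump_nonneg _)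
    (Finset.prod_nonneg fun _ _ => integerBump_nonneg _)
  s_pos i := by positivity
  exists_pos x _ := by
    obtain ⟨b, hb⟩ := exists_integerBump_pos (Real.logb 2 (d x))
    choose b' hb' using fun i => exists_integerBump_pos (x i / 2 ^ ⌊level d b x⌋)
    exact ⟨(b, b'), mul_pos hb (Finset.prod_pos fun i _ => hb' i)⟩
  cont c x hx hG := by
    have hl : ContinuousAt (level d c.1) x :=
      (hd.continuousAt.logb hx.ne').add continuousAt_const
    have h1 := hl.eventually (eventually_floor_eq hG.1)
    have h2 : ∀ᶠ x' in 𝓝 x, ∀ i, Int.fract (scaledCoord c.2 ⌊level d c.1 x⌋ x' i) ≠ 0 ∧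
        ⌊scaledCoord c.2 ⌊level d c.1 x⌋ x' i⌋ = ⌊scaledCoord c.2 ⌊level d c.1 x⌋ x i⌋ :=
      Filter.eventually_all.2 fun i =>
        (continuous_scaledCoord c.2 _ i).continuousAt.eventually (eventually_floor_eq (hG.2 i))
    constructor
    · have h3 : ContinuousAt (fun x' => integerBump (level d c.1 x') *
          ∏ i, integerBump (scaledCoord c.2 ⌊level d c.1 x⌋ x' i)) x :=
        (continuous_integerBump.continuousAt.comp hl).mul
          (continuous_finsetProd _ fun i _ => continuous_integerBump.comp
            (continuous_scaledCoord c.2 _ i)).continuousAt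
      refine h3.congr ?_
      filter_upwards [h1] with x' h
      rw [h.2]
    · filter_upwards [h1, h2] with x' h h'
      refine ⟨⟨h.1, fun i => ?_⟩, Prod.ext h.2 (funext fun i => ?_)⟩
      · rw [h.2]; exact (h' i).1
      · change ⌊scaledCoord c.2 ⌊level d c.1 x'⌋ x' i⌋ = _
        rw [h.2]; exact (h' i).2
  vanish c x hx hG := by
    have hl : ContinuousAt (level d c.1) x :=
      (hd.continuousAt.logb hx.ne').add continuousAt_const
    by_cases hf : Int.fract (level d c.1 x) = 0
    · filter_upwards [hl.eventually (eventually_integerBump_eq_zero hf)] with x' h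
      rw [h, zero_mul]
    · have : ∃ i, Int.fract (scaledCoord c.2 ⌊level d c.1 x⌋ x i) = 0 := by
        by_contra! h
        exact hG ⟨hf, h⟩
      obtain ⟨i, hi⟩ := this
      filter_upwards [hl.eventually (eventually_floor_eq hf),
        (continuous_scaledCoord c.2 _ i).continuousAt.eventually
          (eventually_integerBump_eq_zero hi)] with x' h1 h2
      rw [h1.2, Finset.prod_eq_zero (Finset.mem_univ i) h2, mul_zero]
  le_s c x hx _ := by
    have h1 := Int.lt_floor_add_one (level d c.1 x)
    have h2 : Real.logb 2 (d x) ≤ level d c.1 x := by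
      unfold level; cases c.1 <;> simp
    have h3 := (Real.logb_lt_iff_lt_rpow one_lt_two hx).1 (h2.trans_lt h1)
    rw [show (⌊level d c.1 x⌋ : ℝ) + 1 = ((⌊level d c.1 x⌋ + 1 : ℤ) : ℝ) by push_cast; rfl,
      Real.rpow_intCast] at h3
    exact h3.le
  s_le c x hx _ := by
    have h1 := Int.floor_le (level d c.1 x)
    have h2 : level d c.1 x ≤ Real.logb 2 (d x) + 1 := by
      unfold level; cases c.1 <;> simp; norm_num
    have h3 : ((⌊level d c.1 x⌋ - 1 : ℤ) : ℝ) ≤ Real.logb 2 (d x) := by push_cast; linarith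
    have h4 := (Real.le_logb_iff_rpow_le one_lt_two hx).1 h3
    rw [Real.rpow_intCast] at h4
    calc (2 : ℝ) ^ (⌊level d c.1 x⌋ + 1) = 4 * 2 ^ (⌊level d c.1 x⌋ - 1) := by
          rw [show ⌊level d c.1 x⌋ + 1 = 2 + (⌊level d c.1 x⌋ - 1) by ring,
            zpow_add₀ two_ne_zero]
          norm_num
      _ ≤ 4 * d x := by gcongr
  dist_le c x x' _ _ _ _ hq := by
    have hn : ⌊level d c.1 x⌋ = ⌊level d c.1 x'⌋ := congrArg Prod.fst hq
    have hz : ∀ i, ⌊scaledCoord c.2 ⌊level d c.1 x⌋ x i⌋ =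
        ⌊scaledCoord c.2 ⌊level d c.1 x⌋ x' i⌋ := fun i => by
      have := congrFun (congrArg Prod.snd hq) i
      change _ = ⌊scaledCoord c.2 ⌊level d c.1 x'⌋ x' i⌋ at this
      rwa [← hn] at this
    refine (dist_pi_le_iff (by positivity)).2 fun i => ?_
    have h1 := Int.abs_sub_lt_one_of_floor_eq_floor (hz i)
    have hpos : (0 : ℝ) < 2 ^ ⌊level d c.1 x⌋ := by positivity
    simp only [scaledCoord, add_sub_add_right_eq_sub, ← sub_div, abs_div, abs_of_pos hpos,
      div_lt_one hpos] at h1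
    rw [Real.dist_eq]
    exact h1.le.trans (zpow_le_zpow_right₀ one_le_two (by simp))

end ColoredCells

/-- A compact, locally contractible subset of a Euclidean space is a neighbourhood retract. -/
theorem IsCompact.exists_retraction_thickening {σ : Type*} [Fintype σ] {A : Set (σ → ℝ)}
    (hA : IsCompact A) (hne : A.Nonempty) (hc : PointedLocallyContractible A) :
    ∃ (r : (σ → ℝ) → A) (η : ℝ), 0 < η ∧ ContinuousOn r (Metric.thickening η A) ∧
      ∀ a : A, r a = a := by
  classical
  exact (ColoredCells.dyadic _ (Metric.continuous_infDist_pt A)).exists_retraction hA hne hc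

/-! ### Signed measures as functionals, and weak convergence -/

/-- The unit ball of `Lip(M)` is totally bounded for the uniform norm, by Arzelà–Ascoli. -/
theorem totallyBounded_lipUnitBall {M : Type*} [MetricSpace M] [CompactSpace M] :
    TotallyBounded {f : C(M, ℝ) | ⇑f ∈ lipUnitBall M} := by
  let e := BoundedContinuousFunction.mkOfCompact (α := M) (β := ℝ)
  have himg : TotallyBounded (closure (e '' {f : C(M, ℝ) | ⇑f ∈ lipUnitBall M})) := by
    refine (BoundedContinuousFunction.arzela_ascoli (Set.Icc (-1) 1) isCompact_Icc _ ?_ ?_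
      ).totallyBounded
    · rintro _ x ⟨f, hf, rfl⟩
      exact abs_le.1 (hf.1 x)
    · refine LipschitzWith.uniformEquicontinuous _ 1 ?_ |>.equicontinuous
      rintro ⟨_, f, hf, rfl⟩
      exact hf.2
  have h := totallyBounded_preimage
    (ContinuousMap.isometryEquivBoundedOfCompact M ℝ).isometry.isUniformInducing himg
  refine TotallyBounded.subset (fun f hf => ?_) h
  exact subset_closure ⟨f, hf, rfl⟩

section Pairing

variable {M : Type*} [MetricSpace M] [CompactSpace M] [MeasurableSpace M] [BorelSpace M]

theorem integrable_continuousMap (μ : SignedMeasure M) (f : C(M, ℝ)) :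
    VectorMeasure.Integrable μ f :=
  integrable_of_bounded_continuous μ f.continuous f.norm_coe_le_norm

/-- Integration against a signed measure as a continuous functional on `C(M, ℝ)`. -/
noncomputable def integralFunctional (μ : SignedMeasure M) : C(M, ℝ) →L[ℝ] ℝ :=
  LinearMap.mkContinuous
    { toFun := fun f => ∫ᵛ x, f x ∂<•μ
      map_add' := fun f g => VectorMeasure.integral_fun_add (integrable_continuousMap μ f)
        (integrable_continuousMap μ g)
      map_smul' := fun c f => VectorMeasure.integral_fun_smul _ _ c f }
    (‖(ContinuousLinearMap.lsmul ℝ ℝ (E := ℝ)).flip‖ * μ.variation.real Set.univ) fun f => by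
      have : IsFiniteMeasure μ.variation := by
        rw [← SignedMeasure.totalVariation_eq_variation]; infer_instance
      have := VectorMeasure.norm_integral_le_of_norm_le_const (μ := μ)
        (B := (ContinuousLinearMap.lsmul ℝ ℝ (E := ℝ)).flip) (.of_forall f.norm_coe_le_norm)
      refine this.trans_eq ?_
      ring

theorem integralFunctional_apply (μ : SignedMeasure M) (f : C(M, ℝ)) :
    integralFunctional μ f = ∫ᵛ x, f x ∂<•μ := rfl

theorem integralFunctional_sub (μ ν : SignedMeasure M) (f : C(M, ℝ)) :
    integralFunctional (μ - ν) f = integralFunctional μ f - integralFunctional ν f :=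
  VectorMeasure.integral_sub_vectorMeasure (integrable_continuousMap μ f)
    (integrable_continuousMap ν f)

/-- On a compact space, weak convergence of a sequence of signed measures implies convergence for
the Kantorovich–Rubinstein distance: the functionals are bounded, by the Banach–Steinhaus theorem,
so they converge uniformly on the totally bounded unit ball of `Lip(M)`. -/
theorem WeaklyConverges.tendsto {s : ℕ → SignedMeasure M} {σ : SignedMeasure M}
    (h : WeaklyConverges s σ) : Tendsto s atTop (𝓝 σ) := by
  have h' : ∀ f : C(M, ℝ), Tendsto (fun n => integralFunctional (s n - σ) f) atTop (𝓝 0) := by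
    intro f
    simp only [integralFunctional_sub]
    have := (h f).sub_const (integralFunctional σ f)
    rwa [integralFunctional_apply, sub_self] at this
  obtain ⟨C, hC⟩ := banach_steinhaus (g := fun n => integralFunctional (s n - σ)) fun f => by
    obtain ⟨C, hC⟩ := (h' f).norm.bddAbove_range
    exact ⟨C, fun n => hC ⟨n, rfl⟩⟩
  have hC0 : 0 ≤ C := (norm_nonneg _).trans (hC 0)
  rw [Metric.tendsto_atTop]
  intro ε hε
  obtain ⟨t, ht, hcov⟩ := Metric.totallyBounded_iff.1 (totallyBounded_lipUnitBall (M := M))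
    (ε / 4 / (C + 1)) (by positivity)
  have hev : ∀ᶠ n in atTop, ∀ g ∈ t, |integralFunctional (s n - σ) g| < ε / 4 :=
    (Set.Finite.eventually_all ht).2 fun g _ => by
      have := (h' g).abs
      rw [abs_zero] at this
      exact this.eventually (gt_mem_nhds (by positivity))
  obtain ⟨N, hN⟩ := eventually_atTop.1 hev
  refine ⟨N, fun n hn => ?_⟩
  rw [dist_eq_lipDualNorm]
  refine lt_of_le_of_lt (b := ε / 2) (ciSup_le fun f => ?_) (half_lt_self hε)
  let f' : C(M, ℝ) := ⟨f, f.2.2.continuous⟩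
  obtain ⟨g, hg, hfg⟩ := Set.mem_iUnion₂.1 (hcov (show f' ∈ _ from f.2))
  have e1 : integralFunctional (s n - σ) f' =
      integralFunctional (s n - σ) (f' - g) + integralFunctional (s n - σ) g := by
    rw [← map_add, sub_add_cancel]
  have e2 : |integralFunctional (s n - σ) (f' - g)| ≤ ε / 4 := by
    rw [Metric.mem_ball, dist_eq_norm] at hfg
    calc |integralFunctional (s n - σ) (f' - g)| ≤ ‖integralFunctional (s n - σ)‖ * ‖f' - g‖ :=
          (integralFunctional (s n - σ)).le_opNorm _
      _ ≤ (C + 1) * (ε / 4 / (C + 1)) := by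
        gcongr
        exact (hC n).trans (by linarith)
      _ = ε / 4 := by field_simp
  change |integralFunctional (s n - σ) f'| ≤ ε / 2
  rw [e1]
  have := abs_add_le (integralFunctional (s n - σ) (f' - g)) (integralFunctional (s n - σ) g)
  have := (hN n hn g hg).le
  linarith

/-- A family of signed measures that is weakly continuous in a parameter is continuous for the
Kantorovich–Rubinstein distance. -/
theorem continuous_of_continuous_integralFunctional {Z : Type*} [TopologicalSpace Z]
    [SequentialSpace Z] {g : Z → SignedMeasure M}
    (h : ∀ f : C(M, ℝ), Continuous fun z => integralFunctional (g z) f) : Continuous g := by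
  refine continuous_iff_seqContinuous.2 fun u z hu => ?_
  exact WeaklyConverges.tendsto fun f => ((h f).tendsto z).comp hu

/-- The integral of a fixed Lipschitz function is continuous for the Kantorovich–Rubinstein
distance. -/
theorem continuous_integralFunctional_of_lipschitz {f : C(M, ℝ)} {K : NNReal}
    (hf : LipschitzWith K f) : Continuous fun μ : SignedMeasure M => integralFunctional μ f := by
  have hpos : 0 < ‖f‖ + K + 1 := by positivity
  refine LipschitzWith.continuous (K := ⟨‖f‖ + K + 1, hpos.le⟩)
    (LipschitzWith.of_dist_le_mul fun μ ν => ?_)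
  have hmem : ⇑((‖f‖ + K + 1)⁻¹ • f) ∈ lipUnitBall M := by
    constructor
    · intro x
      have h1 := f.norm_coe_le_norm x
      rw [Real.norm_eq_abs] at h1
      rw [ContinuousMap.smul_apply, smul_eq_mul, abs_mul, abs_of_pos (inv_pos.2 hpos),
        inv_mul_le_iff₀ hpos]
      have := K.coe_nonneg
      linarith
    · refine LipschitzWith.of_dist_le_mul fun x y => ?_
      have h1 := hf.dist_le_mul x y
      rw [ContinuousMap.smul_apply, ContinuousMap.smul_apply, dist_smul₀, norm_inv,
        Real.norm_of_nonneg hpos.le, inv_mul_le_iff₀ hpos, NNReal.coe_one, one_mul]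
      refine h1.trans ?_
      gcongr
      linarith [norm_nonneg f]
  have h1 := le_lipDualNorm (μ - ν) hmem
  rw [← dist_eq_lipDualNorm] at h1
  change |integralFunctional (μ - ν) ((‖f‖ + K + 1)⁻¹ • f)| ≤ _ at h1
  rw [map_smul, smul_eq_mul, abs_mul, abs_of_pos (inv_pos.2 hpos), inv_mul_le_iff₀ hpos,
    integralFunctional_sub] at h1
  exact h1

end Pairing

/-! ### Formal barycenters -/

section Barycenter

variable {M : Type*} [MeasurableSpace M]

/-- The measure `∑ t_j δ_{x_j}`. -/
noncomputable def barycenter {k : ℕ} (t : Fin k → ℝ) (x : Fin k → M) : SignedMeasure M :=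
  ∑ j, t j • VectorMeasure.dirac (x j) (1 : ℝ)

theorem barycenter_mem {k : ℕ} {t : Fin k → ℝ} (ht : t ∈ stdSimplex ℝ (Fin k)) (x : Fin k → M) :
    barycenter t x ∈ formalBarycenters M k :=
  ⟨t, x, ht.1, ht.2, rfl⟩

variable [MetricSpace M] [CompactSpace M] [BorelSpace M]

theorem integralFunctional_barycenter {k : ℕ} (t : Fin k → ℝ) (x : Fin k → M) (f : C(M, ℝ)) :
    integralFunctional (barycenter t x) f = ∑ j, t j * f (x j) := by
  rw [integralFunctional_apply, barycenter, VectorMeasure.integral_finsetSum_vectorMeasure]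
  · simp [VectorMeasure.integral_smul_vectorMeasure]
  · exact fun j _ => integrable_continuousMap _ f

theorem continuous_barycenter {k : ℕ} :
    Continuous fun p : (Fin k → ℝ) × (Fin k → M) => barycenter p.1 p.2 :=
  continuous_of_continuous_integralFunctional fun f => by
    simp only [integralFunctional_barycenter]
    fun_prop

theorem isCompact_formalBarycenters (k : ℕ) : IsCompact (formalBarycenters M k) := by
  have h := ((isCompact_stdSimplex ℝ (Fin k)).prod (isCompact_univ (X := Fin k → M))).image
    continuous_barycenter
  convert h using 1
  ext σ
  constructor
  · rintro ⟨t, x, h0, h1, rfl⟩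
    exact ⟨(t, x), ⟨⟨h0, h1⟩, trivial⟩, rfl⟩
  · rintro ⟨⟨t, x⟩, ⟨ht, -⟩, rfl⟩
    exact barycenter_mem ht x

/-- On the formal barycenters, the integral of a continuous function depends continuously on the
measure and on a parameter in the function. -/
theorem continuous_integralFunctional_formalBarycenters {k : ℕ} {T : Type*} [TopologicalSpace T]
    [CompactSpace T] [T2Space T] {F : T → C(M, ℝ)} (hF : Continuous fun p : T × M => F p.1 p.2) :
    Continuous fun p : formalBarycenters M k × T =>
      integralFunctional (p.1 : SignedMeasure M) (F p.2) := by
  let Q : (stdSimplex ℝ (Fin k) × (Fin k → M)) × T → formalBarycenters M k × T :=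
    fun z => (⟨barycenter z.1.1 z.1.2, barycenter_mem z.1.1.2 _⟩, z.2)
  have hQc : Continuous Q := by
    refine Continuous.prodMk (Continuous.subtype_mk ?_ _) continuous_snd
    exact continuous_barycenter.comp (f := fun z : (stdSimplex ℝ (Fin k) × (Fin k → M)) × T =>
      ((z.1.1 : Fin k → ℝ), z.1.2)) (by fun_prop)
  have hQs : Function.Surjective Q := by
    rintro ⟨⟨_, t, x, h0, h1, rfl⟩, τ⟩
    exact ⟨((⟨t, h0, h1⟩, x), τ), rfl⟩
  have : CompactSpace (stdSimplex ℝ (Fin k)) :=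
    isCompact_iff_compactSpace.1 (isCompact_stdSimplex ℝ (Fin k))
  refine (Topology.IsQuotientMap.of_surjective_continuous hQs hQc).continuous_iff.2 ?_
  have : ((fun p : formalBarycenters M k × T => integralFunctional (p.1 : SignedMeasure M) (F p.2))
      ∘ Q) = fun z => ∑ j, (z.1.1 : Fin k → ℝ) j * F z.2 (z.1.2 j) :=
    funext fun z => integralFunctional_barycenter _ _ _
  rw [this]
  refine continuous_finsetSum _ fun j _ => Continuous.mul ?_ ?_
  · exact (continuous_apply j).comp (continuous_subtype_val.comp (by fun_prop))
  · exact hF.comp (f := fun z : (stdSimplex ℝ (Fin k) × (Fin k → M)) × T => (z.2, z.1.2 j))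
      (by fun_prop)

end Barycenter

/-! ### Local contractibility of the space of formal barycenters -/

theorem PointedLocallyContractible.of_homotopicRel {X : Type*} [TopologicalSpace X]
    (h : ∀ a : X, ∃ N ∈ 𝓝 a, ∃ ha : a ∈ N,
      (⟨Subtype.val, continuous_subtype_val⟩ : C(N, X)).HomotopicRel (ContinuousMap.const N a)
        {⟨a, ha⟩}) : PointedLocallyContractible X := by
  classical
  intro a
  obtain ⟨N, hN, ha, ⟨K⟩⟩ := h a
  have hin : ∀ x (hx : x ∈ N) t, (if h : x ∈ N then K (t, ⟨x, h⟩) else a) = K (t, ⟨x, hx⟩) :=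
    fun x hx t => dif_pos hx
  refine ⟨N, hN, fun x t => if h : x ∈ N then K (t, ⟨x, h⟩) else a, ?_, fun x hx => ?_,
    fun x hx => ?_, fun t => ?_⟩
  · rw [continuousOn_iff_continuous_domRestrict]
    refine (K.continuous.comp (f := fun p : ↥(N ×ˢ (Set.univ : Set unitInterval)) =>
      (p.1.2, (⟨p.1.1, p.2.1⟩ : N))) (by fun_prop)).congr fun p => ?_
    exact (hin _ p.2.1 _).symm
  · exact (hin x hx 0).trans (K.apply_zero _)
  · exact (hin x hx 1).trans (K.apply_one _)
  · exact (hin a ha t).trans (K.eq_fst t rfl)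

/-- In a locally contractible metric space, a neighbourhood of a finite set `S` contracts to `S`.
The neighbourhood is encoded by a cutoff `χ`; where `χ` vanishes, `φ` need not be continuous. -/
theorem PointedLocallyContractible.exists_finset_contraction {M : Type*} [MetricSpace M]
    (h : PointedLocallyContractible M) {S : Finset M} (hS : S.Nonempty) :
    ∃ (χ : C(M, ℝ)) (φ : M → unitInterval → M), (∀ x, 0 ≤ χ x) ∧ (∀ s ∈ S, χ s = 1) ∧
      (∀ x, φ x 0 = x) ∧ (∀ x, φ x 1 ∈ S) ∧ (∀ s ∈ S, ∀ τ, φ s τ = s) ∧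
      ∀ f : C(M, ℝ), Continuous fun p : unitInterval × M => χ p.2 * f (φ p.2 p.1) := by
  classical
  choose N hN H hc h0 h1 hfix using h
  obtain ⟨ρ, hρN, hρ⟩ : ∃ ρ : ℝ, (∀ s ∈ S, Metric.ball s (2 * ρ) ⊆ N s ∧
      ∀ s' ∈ S, s ≠ s' → 2 * ρ ≤ dist s s') ∧ 0 < ρ := by
    have h2 : Tendsto (fun ρ : ℝ => 2 * ρ) (𝓝[>] 0) (𝓝 0) :=
      tendsto_nhdsWithin_of_tendsto_nhds ((continuous_const_mul 2).tendsto' 0 0 (mul_zero 2))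
    refine (((Finset.eventually_all S).2 fun s _ => ?_).and
      (self_mem_nhdsWithin : ∀ᶠ ρ : ℝ in 𝓝[>] 0, ρ ∈ Set.Ioi 0)).exists
    refine Filter.Eventually.and ?_ ((Finset.eventually_all S).2 fun s' _ => ?_)
    · obtain ⟨r, hr, hsub⟩ := Metric.mem_nhds_iff.1 (hN s)
      filter_upwards [h2.eventually (gt_mem_nhds hr)] with ρ hρ
      exact (Metric.ball_subset_ball hρ.le).trans hsub
    · rcases eq_or_ne s s' with rfl | hne
      · exact .of_forall fun _ h => absurd rfl h
      · filter_upwards [h2.eventually (gt_mem_nhds (dist_pos.2 hne))] with ρ hρ _ using hρ.le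
  have huniq : ∀ s ∈ S, ∀ s' ∈ S, ∀ x, dist x s < ρ → dist x s' < ρ → s = s' := by
    intro s hs s' hs' x hx hx'
    by_contra hne
    have := (hρN s hs).2 s' hs' hne
    have := dist_triangle_left s s' x
    linarith
  obtain ⟨s₀, hs₀⟩ := hS
  let χ' : M → M → ℝ := fun s x => max 0 (1 - dist x s / ρ)
  have hχ' : ∀ s x, χ' s x ≠ 0 → dist x s < ρ := by
    intro s x hx
    by_contra! hle
    refine hx (max_eq_left ?_)
    have := (one_le_div hρ).2 hle
    linarith
  have hχc : ∀ s, Continuous (χ' s) := fun s => by fun_prop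
  let φ : M → unitInterval → M := fun x τ => if hx : ∃ s ∈ S, dist x s < ρ then
    H hx.choose x τ else if τ = 1 then s₀ else x
  have hφ : ∀ s ∈ S, ∀ x, dist x s < ρ → ∀ τ, φ x τ = H s x τ := by
    intro s hs x hx τ
    have hex : ∃ s ∈ S, dist x s < ρ := ⟨s, hs, hx⟩
    have : hex.choose = s := huniq _ hex.choose_spec.1 _ hs x hex.choose_spec.2 hx
    simp only [φ, dif_pos hex, this]
  have hφ' : ∀ x, (¬ ∃ s ∈ S, dist x s < ρ) → ∀ τ, φ x τ = if τ = 1 then s₀ else x :=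
    fun x hx τ => dif_neg hx
  have hmem : ∀ s ∈ S, ∀ x, dist x s < ρ → x ∈ N s := fun s hs x hx =>
    (hρN s hs).1 (Metric.mem_ball.2 (by linarith))
  refine ⟨⟨fun x => ∑ s ∈ S, χ' s x, continuous_finsetSum _ fun s _ => hχc s⟩, φ,
    fun x => Finset.sum_nonneg fun s _ => le_max_left _ _, fun s hs => ?_, fun x => ?_, fun x => ?_,
    fun s hs τ => ?_, fun f => ?_⟩
  · change ∑ s' ∈ S, χ' s' s = 1
    rw [Finset.sum_eq_single_of_mem s hs]
    · simp [χ']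
    · intro s' hs' hne
      by_contra h
      exact hne (huniq s' hs' s hs s (hχ' s' s h) (by simpa using hρ))
  · by_cases hx : ∃ s ∈ S, dist x s < ρ
    · obtain ⟨s, hs, hx⟩ := hx
      rw [hφ s hs x hx, h0 s x (hmem s hs x hx)]
    · simp [hφ' x hx]
  · by_cases hx : ∃ s ∈ S, dist x s < ρ
    · obtain ⟨s, hs, hx⟩ := hx
      rwa [hφ s hs x hx, h1 s x (hmem s hs x hx)]
    · simpa [hφ' x hx] using hs₀
  · rw [hφ s hs s (by simpa using hρ), hfix]
  · have : ∀ p : unitInterval × M, (∑ s ∈ S, χ' s p.2) * f (φ p.2 p.1) =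
        ∑ s ∈ S, χ' s p.2 * f (H s p.2 p.1) := by
      intro p
      rw [Finset.sum_mul]
      refine Finset.sum_congr rfl fun s hs => ?_
      by_cases hz : χ' s p.2 = 0
      · rw [hz, zero_mul, zero_mul]
      · rw [hφ s hs _ (hχ' s _ hz)]
    change Continuous fun p : unitInterval × M => (∑ s ∈ S, χ' s p.2) * f (φ p.2 p.1)
    simp only [this]
    refine continuous_finsetSum _ fun s hs => continuous_iff_continuousAt.2 fun p => ?_
    -- inside the ball of radius `2ρ` both factors are continuous; the cutoff vanishes off the ball
    -- of radius `ρ`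
    rcases lt_or_ge (dist p.2 s) (2 * ρ) with hlt | hge
    · refine ((hχc s).comp continuous_snd).continuousAt.mul (f.continuous.continuousAt.comp ?_)
      have hnb : N s ∈ 𝓝 p.2 := mem_of_superset (Metric.isOpen_ball.mem_nhds hlt) (hρN s hs).1
      have h2 : ContinuousAt (fun z : M × unitInterval => H s z.1 z.2) (p.2, p.1) :=
        (hc s).continuousAt (prod_mem_nhds hnb univ_mem)
      exact h2.comp (f := fun p : unitInterval × M => (p.2, p.1))
        (continuous_swap.continuousAt (x := p))
    · have hev : ∀ᶠ z : unitInterval × M in 𝓝 p, ρ < dist z.2 s :=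
        (Continuous.continuousAt (by fun_prop)).eventually (lt_mem_nhds (by linarith))
      refine continuousAt_const.congr (f := fun _ => (0 : ℝ)) ?_
      filter_upwards [hev] with z hz
      by_contra h
      exact absurd (hχ' s z.2 fun h0 => h (by rw [h0, zero_mul])) (not_lt.2 hz.le)

section Barycenter

variable {M : Type*} [MetricSpace M] [CompactSpace M] [MeasurableSpace M] [BorelSpace M]

theorem eq_of_integralFunctional_eq {μ ν : SignedMeasure M}
    (h : ∀ f, integralFunctional μ f = integralFunctional ν f) : μ = ν :=
  tendsto_nhds_unique tendsto_const_nhds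
    (WeaklyConverges.tendsto (s := fun _ => μ) (σ := ν) fun f => by
      have := h f
      rw [integralFunctional_apply, integralFunctional_apply] at this
      simpa only [this] using tendsto_const_nhds)

/-- Reweighting the atoms of a formal barycenter. -/
theorem exists_reweight {k : ℕ} {σ : SignedMeasure M} (hσ : σ ∈ formalBarycenters M k)
    {χ : C(M, ℝ)} (hχ : ∀ x, 0 ≤ χ x) (hZ : 0 < integralFunctional σ χ) (τ : unitInterval) :
    ∃ σ' ∈ formalBarycenters M k, ∀ f, integralFunctional σ' f =
      (1 - τ) * integralFunctional σ f +
        τ * (integralFunctional σ (χ * f) / integralFunctional σ χ) := by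
  obtain ⟨t, x, h0, h1, rfl⟩ := hσ
  change 0 < integralFunctional (barycenter t x) χ at hZ
  change ∃ σ' ∈ formalBarycenters M k, ∀ f, integralFunctional σ' f =
      (1 - τ) * integralFunctional (barycenter t x) f +
        τ * (integralFunctional (barycenter t x) (χ * f) / integralFunctional (barycenter t x) χ)
  set Z := integralFunctional (barycenter t x) χ
  have hZsum : ∑ j, t j * χ (x j) = Z := (integralFunctional_barycenter t x χ).symm
  refine ⟨barycenter (fun j => (1 - τ) * t j + τ * (t j * χ (x j) / Z)) x,
    barycenter_mem ⟨fun j => ?_, ?_⟩ x, fun f => ?_⟩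
  · have := τ.2.1
    have := sub_nonneg.2 τ.2.2
    have := h0 j
    have := hχ (x j)
    positivity
  · rw [Finset.sum_add_distrib, ← Finset.mul_sum, ← Finset.mul_sum, ← Finset.sum_div, hZsum, h1,
      div_self hZ.ne']
    ring
  · simp only [integralFunctional_barycenter, Finset.mul_sum, Finset.sum_div,
      ← Finset.sum_add_distrib, ContinuousMap.mul_apply]
    exact Finset.sum_congr rfl fun j _ => by ring

/-- Reweighting the atoms of a formal barycenter and moving them by `g`. -/
theorem exists_map_reweight {k : ℕ} {σ : SignedMeasure M} (hσ : σ ∈ formalBarycenters M k)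
    {χ : C(M, ℝ)} (hχ : ∀ x, 0 ≤ χ x) (hZ : 0 < integralFunctional σ χ) (g : M → M)
    {F : C(M, ℝ) → C(M, ℝ)} (hF : ∀ f x, F f x = χ x * f (g x)) :
    ∃ σ' ∈ formalBarycenters M k, ∀ f, integralFunctional σ' f =
      integralFunctional σ (F f) / integralFunctional σ χ := by
  obtain ⟨t, x, h0, h1, rfl⟩ := hσ
  change 0 < integralFunctional (barycenter t x) χ at hZ
  change ∃ σ' ∈ formalBarycenters M k, ∀ f, integralFunctional σ' f =
    integralFunctional (barycenter t x) (F f) / integralFunctional (barycenter t x) χ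
  set Z := integralFunctional (barycenter t x) χ
  have hZsum : ∑ j, t j * χ (x j) = Z := (integralFunctional_barycenter t x χ).symm
  refine ⟨barycenter (fun j => t j * χ (x j) / Z) fun j => g (x j),
    barycenter_mem ⟨fun j => ?_, ?_⟩ _, fun f => ?_⟩
  · have := h0 j
    have := hχ (x j)
    positivity
  · rw [← Finset.sum_div, hZsum, div_self hZ.ne']
  · simp only [integralFunctional_barycenter, Finset.sum_div, hF]
    exact Finset.sum_congr rfl fun j _ => by ring

/-- Once the reweighted atoms of `σ` have been moved by `g` into the points `x`, the segment from
the resulting measure to any barycenter of these points stays in the space of formal barycenters: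
collecting the mass arriving at each `x i` shows that no further atoms are needed. -/
theorem exists_segment {k : ℕ} {t : Fin k → ℝ} (ht : t ∈ stdSimplex ℝ (Fin k)) (x : Fin k → M)
    {σ : SignedMeasure M} (hσ : σ ∈ formalBarycenters M k)
    {χ : C(M, ℝ)} (hχ : ∀ x, 0 ≤ χ x) (hZ : 0 < integralFunctional σ χ) {g : M → M}
    (hg : ∀ y, g y ∈ Set.range x)
    {F : C(M, ℝ) → C(M, ℝ)} (hF : ∀ f x, F f x = χ x * f (g x)) (τ : unitInterval) :
    ∃ σ' ∈ formalBarycenters M k, ∀ f, integralFunctional σ' f =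
      (1 - τ) * (integralFunctional σ (F f) / integralFunctional σ χ) +
        τ * integralFunctional (barycenter t x) f := by
  obtain ⟨t', x', h0, h1, rfl⟩ := hσ
  change 0 < integralFunctional (barycenter t' x') χ at hZ
  change ∃ σ' ∈ formalBarycenters M k, ∀ f, integralFunctional σ' f =
    (1 - τ) * (integralFunctional (barycenter t' x') (F f) /
      integralFunctional (barycenter t' x') χ) + τ * integralFunctional (barycenter t x) f
  set Z := integralFunctional (barycenter t' x') χ
  have hZsum : ∑ j, t' j * χ (x' j) = Z := (integralFunctional_barycenter t' x' χ).symm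
  choose κ hκ using hg
  -- the mass that is transported to `x i`
  let m : Fin k → ℝ := fun i => ∑ j with κ (x' j) = i, t' j * χ (x' j) / Z
  refine ⟨barycenter (fun i => (1 - τ) * m i + τ * t i) x,
    barycenter_mem ⟨fun i => ?_, ?_⟩ x, fun f => ?_⟩
  · have := τ.2.1
    have := sub_nonneg.2 τ.2.2
    have := ht.1 i
    have : 0 ≤ m i := Finset.sum_nonneg fun j _ => by
      have := h0 j
      have := hχ (x' j)
      positivity
    positivity
  · rw [Finset.sum_add_distrib, ← Finset.mul_sum, ← Finset.mul_sum, Finset.sum_fiberwise,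
      ← Finset.sum_div, hZsum, ht.2, div_self hZ.ne']
    ring
  · simp only [integralFunctional_barycenter, add_mul, Finset.sum_add_distrib, Finset.mul_sum, hF]
    congr 1
    · have : ∀ i, (1 - (τ : ℝ)) * m i * f (x i) =
          ∑ j with κ (x' j) = i, (1 - (τ : ℝ)) * (t' j * χ (x' j) / Z * f (g (x' j))) := by
        intro i
        rw [mul_assoc, Finset.sum_mul, Finset.mul_sum]
        refine Finset.sum_congr rfl fun j hj => ?_
        rw [← hκ, (Finset.mem_filter.1 hj).2]
      rw [Finset.sum_congr rfl fun i _ => this i, Finset.sum_fiberwise, Finset.sum_div,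
        Finset.mul_sum]
      exact Finset.sum_congr rfl fun j _ => by ring
    · exact Finset.sum_congr rfl fun j _ => by ring

/-- The space of formal barycenters inherits local contractibility. Near `a = ∑ t_j δ_{x_j}`, first
fade out the mass away from the points `x_j`, next contract the atoms to these points, and finally
adjust the weights along a segment. None of the steps increases the number of atoms. -/
theorem pointedLocallyContractible_formalBarycenters (h : PointedLocallyContractible M) (k : ℕ) :
    PointedLocallyContractible (formalBarycenters M k) := by
  classical
  refine .of_homotopicRel fun a => ?_
  obtain ⟨t, x, ht0, ht1, ha⟩ := id a.2
  change (a : SignedMeasure M) = barycenter t x at ha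
  have hk : Nonempty (Fin k) := by
    by_contra hne
    rw [not_nonempty_iff] at hne
    simp at ht1
  obtain ⟨χ, φ, hχ, hχS, hφ0, hφ1, hφS, hφc⟩ := h.exists_finset_contraction
    (S := Finset.univ.image x) (Finset.univ_nonempty.image x)
  have hxS : ∀ j, x j ∈ Finset.univ.image x := fun j =>
    Finset.mem_image_of_mem x (Finset.mem_univ j)
  have haχ : integralFunctional (a : SignedMeasure M) χ = 1 := by
    rw [ha, integralFunctional_barycenter, ← ht1]
    exact Finset.sum_congr rfl fun j _ => by rw [hχS _ (hxS j), mul_one]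
  let F : unitInterval → C(M, ℝ) → C(M, ℝ) := fun τ f =>
    ⟨fun y => χ y * f (φ y τ), (hφc f).comp (f := fun y => (τ, y)) (by fun_prop)⟩
  have hF : ∀ τ f y, F τ f y = χ y * f (φ y τ) := fun _ _ _ => rfl
  have hF0 : ∀ f, F 0 f = χ * f := fun f => by ext y; simp [hF, hφ0]
  have haF : ∀ τ f, integralFunctional (a : SignedMeasure M) (F τ f) =
      integralFunctional (a : SignedMeasure M) f := by
    intro τ f
    rw [ha, integralFunctional_barycenter, integralFunctional_barycenter]
    exact Finset.sum_congr rfl fun j _ => by rw [hF, hφS _ (hxS j), hχS _ (hxS j), one_mul]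
  have hcont : ∀ f : C(M, ℝ), Continuous fun σ : formalBarycenters M k =>
      integralFunctional (σ : SignedMeasure M) f := fun f =>
    (continuous_integralFunctional_formalBarycenters (T := Unit) (F := fun _ => f)
      (by fun_prop)).comp (f := fun σ => (σ, ())) (by fun_prop)
  have hcontF : ∀ f : C(M, ℝ), Continuous fun p : formalBarycenters M k × unitInterval =>
      integralFunctional (p.1 : SignedMeasure M) (F p.2 f) := fun f =>
    continuous_integralFunctional_formalBarycenters (F := fun τ => F τ f) (hφc f)
  let N : Set (formalBarycenters M k) := {σ | 0 < integralFunctional (σ : SignedMeasure M) χ}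
  have haN : a ∈ N := by
    change 0 < integralFunctional (a : SignedMeasure M) χ
    rw [haχ]; exact one_pos
  have hNo : IsOpen N := isOpen_lt continuous_const (hcont χ)
  choose S₁ hS₁ hS₁f using fun (σ : N) (τ : unitInterval) =>
    exists_reweight σ.1.2 hχ σ.2 τ
  choose S₂ hS₂ hS₂f using fun (σ : N) (τ : unitInterval) =>
    exists_map_reweight σ.1.2 hχ σ.2 (fun y => φ y τ) (hF τ)
  choose S₃ hS₃ hS₃f using fun (σ : N) (τ : unitInterval) =>
    exists_segment ⟨ht0, ht1⟩ x σ.1.2 hχ σ.2 (g := fun y => φ y 1)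
      (fun y => by simpa using hφ1 y) (hF 1) τ
  have hZc : Continuous fun p : unitInterval × N =>
      integralFunctional (p.2 : SignedMeasure M) χ := (hcont χ).comp (by fun_prop)
  have hc₁ : Continuous fun p : unitInterval × N =>
      (⟨S₁ p.2 p.1, hS₁ _ _⟩ : formalBarycenters M k) := by
    refine Continuous.subtype_mk (continuous_of_continuous_integralFunctional fun f => ?_) _
    simp only [hS₁f]
    refine ((by fun_prop : Continuous fun p : unitInterval × N => 1 - (p.1 : ℝ)).mul
      ((hcont f).comp (by fun_prop))).add ((by fun_prop : Continuous fun p : unitInterval × N =>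
        (p.1 : ℝ)).mul (((hcont (χ * f)).comp (by fun_prop)).div hZc fun p => p.2.2.ne'))
  have hc₂ : Continuous fun p : unitInterval × N =>
      (⟨S₂ p.2 p.1, hS₂ _ _⟩ : formalBarycenters M k) := by
    refine Continuous.subtype_mk (continuous_of_continuous_integralFunctional fun f => ?_) _
    simp only [hS₂f]
    exact ((hcontF f).comp (f := fun p : unitInterval × N => (p.2.1, p.1)) (by fun_prop)).div hZc
      fun p => p.2.2.ne'
  have hc₃ : Continuous fun p : unitInterval × N =>
      (⟨S₃ p.2 p.1, hS₃ _ _⟩ : formalBarycenters M k) := by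
    refine Continuous.subtype_mk (continuous_of_continuous_integralFunctional fun f => ?_) _
    simp only [hS₃f]
    refine ((by fun_prop : Continuous fun p : unitInterval × N => 1 - (p.1 : ℝ)).mul
      (((hcont (F 1 f)).comp (by fun_prop)).div hZc fun p => p.2.2.ne')).add
      (by fun_prop)
  refine ⟨N, hNo.mem_nhds haN, haN, ?_⟩
  let g₁ : C(N, formalBarycenters M k) := ⟨fun σ => ⟨S₁ σ 1, hS₁ _ _⟩,
    hc₁.comp (f := fun σ => (1, σ)) (by fun_prop)⟩
  let g₂ : C(N, formalBarycenters M k) := ⟨fun σ => ⟨S₂ σ 1, hS₂ _ _⟩,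
    hc₂.comp (f := fun σ => (1, σ)) (by fun_prop)⟩
  have ha₁ : ∀ τ, S₁ ⟨a, haN⟩ τ = a := fun τ => eq_of_integralFunctional_eq fun f => by
    rw [hS₁f, ← hF0, haF, haχ]; ring
  have ha₂ : ∀ τ, S₂ ⟨a, haN⟩ τ = a := fun τ => eq_of_integralFunctional_eq fun f => by
    rw [hS₂f, haF, haχ, div_one]
  have ha₃ : ∀ τ, S₃ ⟨a, haN⟩ τ = a := fun τ => eq_of_integralFunctional_eq fun f => by
    rw [hS₃f, haF, haχ, ← ha]; ring
  refine ContinuousMap.HomotopicRel.trans (g := g₁) ⟨⟨⟨⟨_, hc₁⟩, fun σ => ?_, fun σ => rfl⟩, ?_⟩⟩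
    (ContinuousMap.HomotopicRel.trans (g := g₂)
      ⟨⟨⟨⟨_, hc₂⟩, fun σ => ?_, fun σ => rfl⟩, ?_⟩⟩
      ⟨⟨⟨⟨_, hc₃⟩, fun σ => ?_, fun σ => ?_⟩, ?_⟩⟩)
  · refine Subtype.ext (eq_of_integralFunctional_eq fun f => ?_)
    simp [hS₁f]
  · rintro τ _ rfl
    exact Subtype.ext (ha₁ τ)
  · refine Subtype.ext (eq_of_integralFunctional_eq fun f => ?_)
    simp [g₁, hS₁f, hS₂f, hF0]
  · rintro τ _ rfl
    exact Subtype.ext ((ha₂ τ).trans (ha₁ 1).symm)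
  · refine Subtype.ext (eq_of_integralFunctional_eq fun f => ?_)
    simp [g₂, hS₂f, hS₃f]
  · refine Subtype.ext (eq_of_integralFunctional_eq fun f => ?_)
    simp [hS₃f, ← ha]
  · rintro τ _ rfl
    exact Subtype.ext ((ha₃ τ).trans (ha₂ 1).symm)

end Barycenter

/-! ### Charts and Lipschitz functions on a compact Riemannian manifold -/

/-- Balls in the chart at `a` contract along segments. -/
theorem pointedLocallyContractible_of_chartedSpace {E M : Type*} [NormedAddCommGroup E]
    [NormedSpace ℝ E] [TopologicalSpace M] [ChartedSpace E M] : PointedLocallyContractible M := by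
  intro a
  let e := chartAt E a
  have ha : a ∈ e.source := mem_chart_source E a
  obtain ⟨r, hr, hrt⟩ := Metric.isOpen_iff.1 e.open_target (e a) (e.map_source ha)
  have hmem : ∀ x ∈ e.source ∩ e ⁻¹' Metric.ball (e a) r, ∀ t : unitInterval,
      AffineMap.lineMap (e x) (e a) (t : ℝ) ∈ e.target := fun x hx t =>
    hrt ((convex_ball (e a) r).lineMap_mem hx.2 (Metric.mem_ball_self hr) t.2)
  refine ⟨e.source ∩ e ⁻¹' Metric.ball (e a) r,
    inter_mem (e.open_source.mem_nhds ha)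
      ((e.continuousAt ha).preimage_mem_nhds (Metric.ball_mem_nhds _ hr)),
    fun x t => e.symm (AffineMap.lineMap (e x) (e a) (t : ℝ)), ?_, fun x hx => ?_, fun x hx => ?_,
    fun t => ?_⟩
  · refine e.continuousOn_symm.comp ?_ fun p hp => hmem p.1 hp.1 p.2
    simp only [AffineMap.lineMap_apply_module']
    have h1 : ContinuousOn (fun p : M × unitInterval => e p.1)
        ((e.source ∩ e ⁻¹' Metric.ball (e a) r) ×ˢ Set.univ) :=
      e.continuousOn.comp continuousOn_fst fun p hp => hp.1.1
    have h2 : ContinuousOn (fun p : M × unitInterval => (p.2 : ℝ))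
        ((e.source ∩ e ⁻¹' Metric.ball (e a) r) ×ˢ Set.univ) :=
      (continuous_subtype_val.comp continuous_snd).continuousOn
    exact (h2.smul (continuousOn_const.sub h1)).add h1
  · simpa using e.left_inv hx.1
  · simpa using e.left_inv ha
  · simpa using e.left_inv ha

section Riemannian

variable {E : Type*} [NormedAddCommGroup E] [NormedSpace ℝ E] {M : Type*} [MetricSpace M]
  [ChartedSpace E M] [IsManifold 𝓘(ℝ, E) 1 M]
  [RiemannianBundle (fun x : M => TangentSpace 𝓘(ℝ, E) x)]
  [IsContinuousRiemannianBundle E (fun x : M => TangentSpace 𝓘(ℝ, E) x)]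

-- the target of a chart and of a real function carries its own norm on the tangent spaces
attribute [local instance] normedAddCommGroupTangentSpaceVectorSpace
attribute [local instance] normedSpaceTangentSpaceVectorSpace

/-- The derivative of a `C¹` function is locally bounded for the Riemannian norm. -/
theorem ContMDiff.eventually_abs_mfderiv_le {f : M → ℝ} (hf : ContMDiff 𝓘(ℝ, E) 𝓘(ℝ, ℝ) 1 f)
    (x : M) : ∃ C : NNReal, ∀ᶠ y in 𝓝 x, ∀ v : TangentSpace 𝓘(ℝ, E) y,
      ‖(mfderiv 𝓘(ℝ, E) 𝓘(ℝ, ℝ) f y v : ℝ)‖ₑ ≤ C * ‖v‖ₑ := by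
  obtain ⟨C, hC, hxC⟩ := eventually_enorm_mfderiv_extChartAt_lt 𝓘(ℝ, E) x
  let e := extChartAt 𝓘(ℝ, E) x
  let g : E → ℝ := f ∘ e.symm
  have hg : ContDiffOn ℝ 1 g e.target := by
    rw [← contMDiffOn_iff_contDiffOn]
    exact hf.comp_contMDiffOn (contMDiffOn_extChartAt_symm x)
  have ht : IsOpen e.target := isOpen_extChartAt_target x
  have hfd : ContinuousAt (fderiv ℝ g) (e x) :=
    (hg.continuousOn_fderiv_of_isOpen ht le_rfl).continuousAt
      (ht.mem_nhds (mem_extChartAt_target x))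
  have hb : ∀ᶠ y in 𝓝 x, ‖fderiv ℝ g (e y)‖₊ < ‖fderiv ℝ g (e x)‖₊ + 1 := by
    have := (hfd.comp (f := e) (continuousAt_extChartAt x)).nnnorm
    exact this.eventually (gt_mem_nhds (lt_add_one _))
  refine ⟨(‖fderiv ℝ g (e x)‖₊ + 1) * C, ?_⟩
  filter_upwards [hb, hxC, extChartAt_source_mem_nhds (I := 𝓘(ℝ, E)) x]
    with y h1 h2 h3 v
  have hy : mfderiv 𝓘(ℝ, E) 𝓘(ℝ, ℝ) f y =
      (fderiv ℝ g (e y)).comp (mfderiv 𝓘(ℝ, E) 𝓘(ℝ, E) e y) := by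
    have hfe : f =ᶠ[𝓝 y] g ∘ e := by
      filter_upwards [(isOpen_extChartAt_source (I := 𝓘(ℝ, E)) x).mem_nhds h3] with z hz
      exact congrArg f (e.left_inv hz).symm
    rw [hfe.mfderiv_eq, ← mfderiv_eq_fderiv]
    refine mfderiv_comp y ?_ ?_
    · exact ((hg.differentiableOn one_ne_zero).differentiableAt
        (ht.mem_nhds (e.map_source h3))).mdifferentiableAt
    · exact mdifferentiableAt_extChartAt (by simpa using h3)
  have hv : (mfderiv 𝓘(ℝ, E) 𝓘(ℝ, ℝ) f y v : ℝ) =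
      fderiv ℝ g (e y) (mfderiv 𝓘(ℝ, E) 𝓘(ℝ, E) e y v) := congr($hy v)
  rw [hv]
  refine (ContinuousLinearMap.le_opENorm (fderiv ℝ g (e y)) _).trans ?_
  push_cast
  rw [mul_assoc]
  refine mul_le_mul' (by exact_mod_cast h1.le) ?_
  refine (ContinuousLinearMap.le_opENorm (mfderiv 𝓘(ℝ, E) 𝓘(ℝ, E) e y) v).trans ?_
  gcongr
  exact h2.le

/-- A `C¹` function on a compact Riemannian manifold is Lipschitz for the Riemannian distance:
its variation along a path is at most a multiple of the length of the path. -/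
theorem ContMDiff.exists_lipschitzWith [CompactSpace M] [IsRiemannianManifold 𝓘(ℝ, E) M]
    {f : M → ℝ} (hf : ContMDiff 𝓘(ℝ, E) 𝓘(ℝ, ℝ) 1 f) : ∃ K, LipschitzWith K f := by
  choose C hC using hf.eventually_abs_mfderiv_le
  obtain ⟨t, ht⟩ := CompactSpace.elim_nhds_subcover _ hC
  obtain ⟨K, hK0, hK⟩ : ∃ K : NNReal, K ≠ 0 ∧ ∀ y, ∀ v : TangentSpace 𝓘(ℝ, E) y,
      ‖(mfderiv 𝓘(ℝ, E) 𝓘(ℝ, ℝ) f y v : ℝ)‖ₑ ≤ K * ‖v‖ₑ := by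
    refine ⟨t.sup C + 1, by positivity, fun y v => ?_⟩
    have hy : y ∈ ⋃ x ∈ t, {y | ∀ v : TangentSpace 𝓘(ℝ, E) y,
        ‖(mfderiv 𝓘(ℝ, E) 𝓘(ℝ, ℝ) f y v : ℝ)‖ₑ ≤ C x * ‖v‖ₑ} := ht ▸ Set.mem_univ y
    obtain ⟨x, hx, hxy⟩ := Set.mem_iUnion₂.1 hy
    refine (hxy v).trans ?_
    gcongr
    exact (Finset.le_sup hx).trans (le_add_of_nonneg_right zero_le_one)
  refine ⟨K, fun x y => ?_⟩
  by_contra! hlt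
  have hlt' : Manifold.riemannianEDist 𝓘(ℝ, E) x y < edist (f x) (f y) / K := by
    rw [← IsRiemannianManifold.out (I := 𝓘(ℝ, E)) x y,
      ENNReal.lt_div_iff_mul_lt (by simp [hK0]) (by simp), mul_comm]
    exact hlt
  obtain ⟨γ, hγ0, hγ1, hγ, hlen, -⟩ :=
    Manifold.exists_lt_locally_constant_of_riemannianEDist_lt hlt' zero_lt_one
  refine absurd ?_ (lt_irrefl (edist (f x) (f y)))
  calc edist (f x) (f y) = ‖(f ∘ γ) 1 - (f ∘ γ) 0‖ₑ := by
        rw [edist_comm, edist_eq_enorm_sub, Function.comp, Function.comp, hγ0, hγ1]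
    _ ≤ ∫⁻ t in Set.Icc 0 1, ‖derivWithin (f ∘ γ) (Set.Icc 0 1) t‖ₑ := by
        apply enorm_sub_le_lintegral_derivWithin_Icc_of_contDiffOn_Icc _ zero_le_one
        rw [← contMDiffOn_iff_contDiffOn]
        exact (hf.comp hγ).contMDiffOn
    _ = ∫⁻ t in Set.Icc (0 : ℝ) 1,
          ‖(mfderivWithin 𝓘(ℝ, ℝ) 𝓘(ℝ, ℝ) (f ∘ γ) (Set.Icc 0 1) t (1 : ℝ) : ℝ)‖ₑ := by
        simp_rw [← fderivWithin_derivWithin, mfderivWithin_eq_fderivWithin]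
        rfl
    _ ≤ ∫⁻ t in Set.Icc (0 : ℝ) 1,
          K * ‖mfderivWithin 𝓘(ℝ, ℝ) 𝓘(ℝ, E) γ (Set.Icc 0 1) t (1 : ℝ)‖ₑ := by
        refine setLIntegral_mono' measurableSet_Icc fun t ht => ?_
        have h1 : mfderivWithin 𝓘(ℝ, ℝ) 𝓘(ℝ, ℝ) (f ∘ γ) (Set.Icc 0 1) t =
            (mfderiv 𝓘(ℝ, E) 𝓘(ℝ, ℝ) f (γ t)).comp
              (mfderivWithin 𝓘(ℝ, ℝ) 𝓘(ℝ, E) γ (Set.Icc 0 1) t) := by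
          apply mfderiv_comp_mfderivWithin
          · exact hf.mdifferentiable one_ne_zero _
          · exact (hγ.mdifferentiable one_ne_zero).mdifferentiableOn _ ht
          · rw [uniqueMDiffWithinAt_iff_uniqueDiffWithinAt]
            exact uniqueDiffOn_Icc zero_lt_one _ ht
        have h2 : (mfderivWithin 𝓘(ℝ, ℝ) 𝓘(ℝ, ℝ) (f ∘ γ) (Set.Icc 0 1) t (1 : ℝ) : ℝ) =
            mfderiv 𝓘(ℝ, E) 𝓘(ℝ, ℝ) f (γ t)
              (mfderivWithin 𝓘(ℝ, ℝ) 𝓘(ℝ, E) γ (Set.Icc 0 1) t (1 : ℝ)) := congr($h1 (1 : ℝ))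
        rw [h2]
        exact hK _ _
    _ = K * Manifold.pathELength 𝓘(ℝ, E) γ 0 1 := by
        rw [lintegral_const_mul' _ _ ENNReal.coe_ne_top,
          Manifold.pathELength_eq_lintegral_mfderivWithin_Icc]
        rfl
    _ < K * (edist (f x) (f y) / K) := by
        gcongr
        exact ENNReal.coe_ne_top
    _ ≤ edist (f x) (f y) := ENNReal.mul_div_le

end Riemannian

/-! ### Finitely many Lipschitz functions that separate the formal barycenters -/

/-- If `V` contains the constants and separates points, then `V ^ n`, the span of the products of
`n` elements of `V`, has an element that is `1` at a given point and `0` at `n` others: a product of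
`n` functions each of which takes care of one of the other points. -/
theorem exists_mem_pow_eq_one_eq_zero {M : Type*} [TopologicalSpace M]
    {V : Submodule ℝ C(M, ℝ)} (h1 : 1 ∈ V)
    (hV : ∀ x y : M, x ≠ y → ∃ f ∈ V, f x ≠ f y) (s : M) (n : ℕ) :
    ∀ T : Finset M, s ∉ T → T.card ≤ n → ∃ g ∈ V ^ n, g s = 1 ∧ ∀ s' ∈ T, g s' = 0 := by
  classical
  induction n with
  | zero =>
    intro T _ hT
    obtain rfl := Finset.card_eq_zero.1 (Nat.le_zero.1 hT)
    exact ⟨1, by rw [pow_zero]; exact Submodule.one_le.1 le_rfl, rfl, by simp⟩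
  | succ n ih =>
    intro T hsT hT
    rcases T.eq_empty_or_nonempty with rfl | ⟨s', hs'⟩
    · obtain ⟨g, hg, hgs, -⟩ := ih ∅ (by simp) (by simp)
      exact ⟨g * 1, by rw [pow_succ]; exact Submodule.mul_mem_mul hg h1, by simpa using hgs,
        by simp⟩
    · obtain ⟨g, hg, hgs, hgT⟩ := ih (T.erase s') (fun h => hsT (Finset.mem_of_mem_erase h))
        (by rw [Finset.card_erase_of_mem hs']; omega)
      obtain ⟨f, hf, hne⟩ := hV s s' fun h => hsT (h ▸ hs')
      have hne' : f s - f s' ≠ 0 := sub_ne_zero.2 hne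
      refine ⟨g * ((f s - f s')⁻¹ • (f - f s' • 1)), ?_, ?_, fun z hz => ?_⟩
      · rw [pow_succ]
        exact Submodule.mul_mem_mul hg (V.smul_mem _ (V.sub_mem hf (V.smul_mem _ h1)))
      · simp [hgs, hne']
      · by_cases hzs : z = s'
        · simp [hzs]
        · simp [hgT z (Finset.mem_erase.2 ⟨hzs, hz⟩)]

theorem exists_mem_pow_interpolation {M : Type*} [TopologicalSpace M]
    {V : Submodule ℝ C(M, ℝ)} (h1 : 1 ∈ V)
    (hV : ∀ x y : M, x ≠ y → ∃ f ∈ V, f x ≠ f y) {n : ℕ} {T : Finset M} (hT : T.card ≤ n)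
    (f : C(M, ℝ)) : ∃ g ∈ V ^ n, ∀ s ∈ T, g s = f s := by
  classical
  choose! l hl hls hlT using fun s => exists_mem_pow_eq_one_eq_zero h1 hV s n (T.erase s)
    (Finset.notMem_erase s T) ((Finset.card_le_card (Finset.erase_subset s T)).trans hT)
  refine ⟨∑ s ∈ T, f s • l s, Submodule.sum_mem _ fun s _ => Submodule.smul_mem _ _ (hl s),
    fun s hs => ?_⟩
  rw [ContinuousMap.sum_apply, Finset.sum_eq_single_of_mem s hs]
  · simp [hls]
  · intro s' hs' hne
    simp [hlT s' s (Finset.mem_erase.2 ⟨hne.symm, hs⟩)]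

section Separation

variable {M : Type*} [MetricSpace M] [CompactSpace M]

theorem exists_lipschitzWith_mul {f g : C(M, ℝ)} (hf : ∃ K, LipschitzWith K f)
    (hg : ∃ K, LipschitzWith K g) : ∃ K, LipschitzWith K ⇑(f * g) := by
  obtain ⟨K, hK⟩ := hf
  obtain ⟨L, hL⟩ := hg
  refine ⟨‖f‖₊ * L + ‖g‖₊ * K, LipschitzWith.of_dist_le_mul fun x y => ?_⟩
  have h1 := hK.dist_le_mul x y
  have h2 := hL.dist_le_mul x y
  rw [Real.dist_eq] at h1 h2 ⊢
  have h3 := f.norm_coe_le_norm x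
  have h4 := g.norm_coe_le_norm y
  rw [Real.norm_eq_abs] at h3 h4
  rw [ContinuousMap.mul_apply, ContinuousMap.mul_apply,
    show f x * g x - f y * g y = f x * (g x - g y) + g y * (f x - f y) by ring]
  calc |f x * (g x - g y) + g y * (f x - f y)|
      ≤ |f x| * |g x - g y| + |g y| * |f x - f y| := by
        rw [← abs_mul, ← abs_mul]; exact abs_add_le _ _
    _ ≤ ‖f‖ * (L * dist x y) + ‖g‖ * (K * dist x y) := by gcongr
    _ = _ := by push_cast; ring

/-- The subalgebra of Lipschitz functions on a compact metric space. -/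
def lipschitzSubalgebra (M : Type*) [MetricSpace M] [CompactSpace M] : Subalgebra ℝ C(M, ℝ) where
  carrier := {f | ∃ K, LipschitzWith K f}
  mul_mem' := exists_lipschitzWith_mul
  add_mem' := fun ⟨K, hK⟩ ⟨L, hL⟩ => ⟨K + L, hK.add hL⟩
  algebraMap_mem' c := ⟨0, LipschitzWith.const c⟩

variable [MeasurableSpace M] [BorelSpace M]

/-- Given finitely many Lipschitz functions that separate the points of `M`, finitely many
polynomials in them separate the formal barycenters: a formal barycenter has at most `k` atoms, so
two of them are distinguished by a function with prescribed values at `2 * k` points. -/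
theorem exists_finite_injOn_formalBarycenters {n : ℕ} {u : Fin n → C(M, ℝ)}
    (hu : ∀ i, ∃ K, LipschitzWith K (u i)) (hsep : ∀ x y : M, x ≠ y → ∃ i, u i x ≠ u i y) (k : ℕ) :
    ∃ B : Finset C(M, ℝ), (∀ f ∈ B, ∃ K, LipschitzWith K f) ∧
      Set.InjOn (fun (μ : SignedMeasure M) (f : B) => integralFunctional μ f)
        (formalBarycenters M k) := by
  classical
  let V : Submodule ℝ C(M, ℝ) := Submodule.span ℝ (insert 1 (Set.range u))
  have h1 : (1 : C(M, ℝ)) ∈ V := Submodule.subset_span (Set.mem_insert _ _)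
  have hV : ∀ x y : M, x ≠ y → ∃ f ∈ V, f x ≠ f y := fun x y hxy => by
    obtain ⟨i, hi⟩ := hsep x y hxy
    exact ⟨u i, Submodule.subset_span (Set.mem_insert_of_mem _ ⟨i, rfl⟩), hi⟩
  have hVfg : V.FG := Submodule.fg_span ((Set.finite_range u).insert 1)
  have hVlip : V ≤ Subalgebra.toSubmodule (lipschitzSubalgebra M) := by
    refine Submodule.span_le.2 ?_
    rintro f (rfl | ⟨i, rfl⟩)
    · exact (lipschitzSubalgebra M).one_mem
    · exact hu i
  have hpow : ∀ n, V ^ n ≤ Subalgebra.toSubmodule (lipschitzSubalgebra M) := by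
    intro n
    induction n with
    | zero =>
      rw [pow_zero, Submodule.one_le]
      exact (lipschitzSubalgebra M).one_mem
    | succ n ih =>
      rw [pow_succ, Submodule.mul_le]
      exact fun f hf g hg => (lipschitzSubalgebra M).mul_mem (ih hf) (hVlip hg)
  obtain ⟨B, hB⟩ := hVfg.pow (k + k)
  refine ⟨B, fun f hf => hpow (k + k) (hB ▸ Submodule.subset_span hf), ?_⟩
  rintro _ ⟨t, x, -, -, rfl⟩ _ ⟨t', x', -, -, rfl⟩ heq
  change (fun f : B => integralFunctional (barycenter t x) f) =
    (fun f : B => integralFunctional (barycenter t' x') f) at heq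
  have hspan : ∀ g ∈ V ^ (k + k), integralFunctional (barycenter t x) g =
      integralFunctional (barycenter t' x') g := by
    intro g hg
    rw [← hB] at hg
    exact LinearMap.eqOn_span (f := (integralFunctional (barycenter t x)).toLinearMap)
      (g := (integralFunctional (barycenter t' x')).toLinearMap)
      (fun f hf => congrFun heq ⟨f, hf⟩) hg
  change barycenter t x = barycenter t' x'
  refine eq_of_integralFunctional_eq fun f => ?_
  obtain ⟨g, hg, hgT⟩ := exists_mem_pow_interpolation h1 hV
    (T := Finset.univ.image x ∪ Finset.univ.image x') (n := k + k)
    ((Finset.card_union_le _ _).trans (add_le_add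
      (Finset.card_image_le.trans (by simp)) (Finset.card_image_le.trans (by simp)))) f
  have h3 : integralFunctional (barycenter t x) f = integralFunctional (barycenter t x) g := by
    rw [integralFunctional_barycenter, integralFunctional_barycenter]
    exact Finset.sum_congr rfl fun j _ => by rw [hgT _ (by simp)]
  have h4 : integralFunctional (barycenter t' x') f = integralFunctional (barycenter t' x') g := by
    rw [integralFunctional_barycenter, integralFunctional_barycenter]
    exact Finset.sum_congr rfl fun j _ => by rw [hgT _ (by simp)]
  rw [h3, h4, hspan g hg]

/-! ### The retraction -/

/-- The formal barycenters are a neighbourhood retract in the signed measures: they are homeomorphic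
to a compact, locally contractible subset of a Euclidean space by a map that extends continuously to
all signed measures. -/
theorem exists_retraction_formalBarycenters (hM : PointedLocallyContractible M) {n : ℕ}
    {u : Fin n → C(M, ℝ)} (hu : ∀ i, ∃ K, LipschitzWith K (u i))
    (hsep : ∀ x y : M, x ≠ y → ∃ i, u i x ≠ u i y) (k : ℕ) :
    ∃ ε : ℝ, 0 < ε ∧ ∃ ψ : SignedMeasure M → SignedMeasure M,
      ContinuousOn ψ (Metric.thickening ε (formalBarycenters M k)) ∧
      (∀ σ ∈ Metric.thickening ε (formalBarycenters M k), ψ σ ∈ formalBarycenters M k) ∧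
      ∀ σ ∈ formalBarycenters M k, ψ σ = σ := by
  rcases (formalBarycenters M k).eq_empty_or_nonempty with hemp | hne
  · exact ⟨1, one_pos, id, continuousOn_id, by simp [hemp], by simp⟩
  obtain ⟨B, hBlip, hinj⟩ := exists_finite_injOn_formalBarycenters hu hsep k
  let L : SignedMeasure M → B → ℝ := fun μ f => integralFunctional μ f
  have hL : Continuous L := continuous_pi fun f => by
    obtain ⟨K, hK⟩ := hBlip f f.2
    exact continuous_integralFunctional_of_lipschitz hK
  have hcomp := isCompact_formalBarycenters (M := M) k
  have : CompactSpace (formalBarycenters M k) := isCompact_iff_compactSpace.1 hcomp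
  let e₀ : formalBarycenters M k ≃ L '' formalBarycenters M k := Equiv.Set.imageOfInjOn L _ hinj
  have he₀ : Continuous e₀ := (hL.comp continuous_subtype_val).subtype_mk _
  let e : formalBarycenters M k ≃ₜ L '' formalBarycenters M k := he₀.homeoOfEquivCompactToT2
  obtain ⟨r, η, hη, hr, hrA⟩ := (hcomp.image hL).exists_retraction_thickening (hne.image L)
    ((pointedLocallyContractible_formalBarycenters hM k).of_homeomorph e)
  obtain ⟨ε, hε, hsub⟩ := hcomp.exists_thickening_subset_open
    (Metric.isOpen_thickening.preimage hL) (t := L ⁻¹' Metric.thickening η (L '' _))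
    fun σ hσ => Metric.self_subset_thickening hη _ (Set.mem_image_of_mem L hσ)
  refine ⟨ε, hε, fun σ => e.symm (r (L σ)), ?_, fun σ _ => (e.symm (r (L σ))).2, fun σ hσ => ?_⟩
  · exact continuous_subtype_val.comp_continuousOn
      (e.symm.continuous.comp_continuousOn (hr.comp hL.continuousOn hsub))
  · have h1 : (⟨L σ, Set.mem_image_of_mem L hσ⟩ : L '' formalBarycenters M k) = e ⟨σ, hσ⟩ := rfl
    have h2 : r (L σ) = e ⟨σ, hσ⟩ := (hrA ⟨L σ, Set.mem_image_of_mem L hσ⟩).trans h1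
    change ((e.symm (r (L σ)) : formalBarycenters M k) : SignedMeasure M) = σ
    rw [h2, e.symm_apply_apply]

end Separation

theorem proposition2p2 {M : Type*} [MetricSpace M] [CompactSpace M]
    [ChartedSpace (EuclideanSpace ℝ (Fin 2)) M] [IsManifold (𝓡 2) ∞ M]
    [RiemannianBundle (fun x : M => TangentSpace (𝓡 2) x)]
    [IsContMDiffRiemannianBundle (𝓡 2) ∞ (EuclideanSpace ℝ (Fin 2))
      (fun x : M => TangentSpace (𝓡 2) x)]
    [IsRiemannianManifold (𝓡 2) M]
    [MeasurableSpace M] [BorelSpace M] (k : ℕ) :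
    ∃ ε₁ : ℝ, 0 < ε₁ ∧ ∀ ε₀ : ℝ, 0 < ε₀ → ε₀ ≤ ε₁ →
      ∃ ψ : SignedMeasure M → SignedMeasure M,
        ContinuousOn ψ (Metric.thickening ε₀ (formalBarycenters M k)) ∧
        Set.MapsTo ψ (Metric.thickening ε₀ (formalBarycenters M k)) (formalBarycenters M k) ∧
        (∀ σ ∈ formalBarycenters M k, ψ σ = σ) ∧
        ∀ (s : ℕ → SignedMeasure M), ∀ σ ∈ formalBarycenters M k, WeaklyConverges s σ →
          (∀ᶠ n in atTop, s n ∈ Metric.thickening ε₀ (formalBarycenters M k)) ∧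
          Tendsto (fun n => ψ (s n)) atTop (𝓝 σ) := by
  have : IsManifold (𝓡 2) 1 M := .of_le (n := ∞) (by simp)
  have : IsContinuousRiemannianBundle (EuclideanSpace ℝ (Fin 2))
      (fun x : M => TangentSpace (𝓡 2) x) := by
    obtain ⟨g, hg, hgi⟩ := IsContMDiffRiemannianBundle.exists_contMDiff (IB := 𝓡 2) (n := ∞)
      (F := EuclideanSpace ℝ (Fin 2)) (E := fun x : M => TangentSpace (𝓡 2) x)
    exact ⟨g, hg.continuous, hgi⟩
  obtain ⟨n, e, he, hemb, -⟩ := exists_embedding_euclidean_of_compact (I := 𝓡 2) (M := M)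
  have hcoord : ∀ i, ContMDiff (𝓡 2) 𝓘(ℝ, ℝ) 1 fun x => e x i := fun i =>
    ((EuclideanSpace.proj (𝕜 := ℝ) i).contMDiff.comp he).of_le (by simp)
  obtain ⟨ε₁, hε₁, ψ, hψc, hψm, hψ⟩ := exists_retraction_formalBarycenters (M := M)
    (pointedLocallyContractible_of_chartedSpace (E := EuclideanSpace ℝ (Fin 2)))
    (u := fun i => ⟨fun x => e x i, (hcoord i).continuous⟩)
    (fun i => (hcoord i).exists_lipschitzWith)
    (fun x y hxy => by
      by_contra! h
      exact hxy (hemb.injective (PiLp.ext h))) k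
  refine ⟨ε₁, hε₁, fun ε₀ hε₀ hle => ?_⟩
  have hsub := Metric.thickening_mono hle (formalBarycenters M k)
  refine ⟨ψ, hψc.mono hsub, fun σ hσ => hψm σ (hsub hσ), hψ, fun s σ hσ hs => ?_⟩
  have hnhds : Metric.thickening ε₀ (formalBarycenters M k) ∈ 𝓝 σ :=
    Metric.isOpen_thickening.mem_nhds (Metric.self_subset_thickening hε₀ _ hσ)
  refine ⟨hs.tendsto.eventually_mem hnhds, ?_⟩
  have := ((hψc.mono hsub).continuousAt hnhds).tendsto.comp hs.tendsto
  rwa [hψ σ hσ] at this
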